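/- A storyplan of a finite simple graph $G$ on time steps $1,\dots,\ell$ assigns to every vertex $v$ a nonempty visible interval $A(v)\subseteq\{1,\dots,\ell\}$ of consecutive time steps, such that $A(u)\cap A(v)\neq\emptyset$ for adjacent $u,v$, together with one fixed drawing of every vertex as a point of the Euclidean plane and of every edge as a simple curve between its end vertices. The frame at time $t$ is the drawing of the subgraph induced by the vertices visible at $t$. The storyplan is planar if every frame is a planar (crossing-free) drawing, and planar geometric if moreover every edge in every frame is a straight-line segment. Let $G$ be the graph with the 28 vertices $a_i,b_i,c_i$ $(1\le i\le 4)$ and $q_i^j,r_i^j$ $(1\le i\le 4,\ 1\le j\le 2)$ and, with $i^+=i \bmod 4+1$, the edges $a_ia_{i^+}$, $b_ib_{i^+}$, $c_ic_{i^+}$ (three 4-cycles); $q_i^ja_k$, $q_i^jb_k$, $q_i^jc_k$ for all $i,k\in\{1,\dots,4\}$ and $j\in\{1,2\}$; $r_i^jq_i^j$; and $r_i^ja_i$, $r_i^ja_{i^+}$, $r_i^jb_i$, $r_i^jb_{i^+}$, $r_i^jc_i$, $r_i^jc_{i^+}$. **Theorem.** The graph $G$ admits a planar storyplan but no planar geometric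 storyplan (with any number of frames). More precisely, $G$ admits a planar storyplan with eight frames in which all vertices $a_i,b_i,c_i$ are visible in all frames and $q_i^j,r_i^j$ are visible exactly in frame $4(j-1)+i$. -/

import Mathlib

/-- The Euclidean plane. -/
abbrev Plane : Type := EuclideanSpace ℝ (Fin 2)

/-- `C` is a simple curve (Jordan arc) with end points `p` and `q`. -/
def IsSimpleCurve (p q : Plane) (C : Set Plane) : Prop :=
  ∃ γ : ℝ → Plane, ContinuousOn γ (Set.Icc 0 1) ∧ Set.InjOn γ (Set.Icc 0 1) ∧
    γ 0 = p ∧ γ 1 = q ∧ γ '' Set.Icc 0 1 = C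

/-- The edges of the subgraph of `G` induced by the vertex set `W`, as edges of `G`. -/
def inducedEdges {V : Type*} (G : SimpleGraph V) (W : Set V) : Set (Sym2 V) :=
  {e | e ∈ G.edgeSet ∧ ∀ v ∈ e, v ∈ W}

/-- The vertex positions `pos` and edge curves `curve`, restricted to the induced subgraph `G[W]`,
form a planar drawing: distinct vertices are distinct points, every edge is a simple curve between
its end vertices, an edge passes through no vertex other than its ends, and two distinct edges meet
at most in common end vertices. -/
structure IsPlanarDrawing {V : Type*} (G : SimpleGraph V) (W : Set V)
    (pos : V → Plane) (curve : Sym2 V → Set Plane) : Prop where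
  pos_injOn : Set.InjOn pos W
  isSimpleCurve : ∀ u ∈ W, ∀ v ∈ W, G.Adj u v → IsSimpleCurve (pos u) (pos v) (curve s(u, v))
  mem_of_pos_mem : ∀ e ∈ inducedEdges G W, ∀ v ∈ W, pos v ∈ curve e → v ∈ e
  inter_subset : ∀ e ∈ inducedEdges G W, ∀ f ∈ inducedEdges G W, e ≠ f →
    curve e ∩ curve f ⊆ {x | ∃ v, v ∈ e ∧ v ∈ f ∧ pos v = x}

/-- The data `(A, 𝒟)` of a storyplan of `G` on the time steps `1, …, ℓ`: every vertex `v` has a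
nonempty visible interval `A(v) = [first v, last v] ⊆ [1, ℓ]`, the intervals of adjacent vertices
intersect, and every vertex and every edge has one drawing, used in all frames which show it.
The condition on the single frames is stated in `IsPlanar` and `IsPlanarGeometric`
(a planar drawing is in particular a simple drawing). -/
structure Storyplan {V : Type*} (G : SimpleGraph V) (ℓ : ℕ) where
  first : V → ℕ
  last : V → ℕ
  one_le_first : ∀ v, 1 ≤ first v
  first_le_last : ∀ v, first v ≤ last v
  last_le : ∀ v, last v ≤ ℓ
  coOccur : ∀ u v, G.Adj u v → (Set.Icc (first u) (last u) ∩ Set.Icc (first v) (last v)).Nonempty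
  pos : V → Plane
  curve : Sym2 V → Set Plane

namespace Storyplan

variable {V : Type*} {G : SimpleGraph V} {ℓ : ℕ}

/-- The set of vertices visible at time `t`. -/
def visible (S : Storyplan G ℓ) (t : ℕ) : Set V :=
  {v | t ∈ Set.Icc (S.first v) (S.last v)}

/-- Each frame is a planar drawing of the subgraph induced by the vertices visible in it. -/
def IsPlanar (S : Storyplan G ℓ) : Prop :=
  ∀ t ∈ Set.Icc 1 ℓ, IsPlanarDrawing G (S.visible t) S.pos S.curve

/-- Each frame is a planar drawing in which every edge is a straight-line segment. -/
def IsPlanarGeometric (S : Storyplan G ℓ) : Prop :=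
  ∀ t ∈ Set.Icc 1 ℓ, IsPlanarDrawing G (S.visible t) S.pos S.curve ∧
    ∀ u ∈ S.visible t, ∀ v ∈ S.visible t, G.Adj u v →
      S.curve s(u, v) = segment ℝ (S.pos u) (S.pos v)

end Storyplan

/-- `G` admits a planar (topological) storyplan. -/
def AdmitsPlanarStoryplan {V : Type*} (G : SimpleGraph V) : Prop :=
  ∃ (ℓ : ℕ) (S : Storyplan G ℓ), S.IsPlanar

/-- `G` admits a planar geometric (straight-line) storyplan. -/
def AdmitsPlanarGeometricStoryplan {V : Type*} (G : SimpleGraph V) : Prop :=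
  ∃ (ℓ : ℕ) (S : Storyplan G ℓ), S.IsPlanarGeometric

/-- The vertices of the witness graph. All indices start at `0`: the vertices of the three
four-cycles `A`, `B`, `C` are `cyc c k` with `c = 0, 1, 2`; the apex vertices are `apex i j`, and
the edge vertices are `edg i j`. -/
inductive WitnessVertex : Type
  | cyc (c : Fin 3) (k : Fin 4)
  | apex (i : Fin 4) (j : Fin 2)
  | edg (i : Fin 4) (j : Fin 2)
  deriving DecidableEq, Fintype

/-- The edges of the witness graph, each listed in one direction. Addition in `Fin 4` is cyclic. -/
def WitnessRel : WitnessVertex → WitnessVertex → Prop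
  | .cyc c k, .cyc c' k' => c' = c ∧ k' = k + 1
  | .apex _ _, .cyc _ _ => True
  | .edg i j, .apex i' j' => i' = i ∧ j' = j
  | .edg i _, .cyc _ k => k = i ∨ k = i + 1
  | _, _ => False

/-- The witness graph: three four-cycles, eight apex vertices joined to all cycle vertices, and
eight edge vertices, each joined to its apex vertex and to the ends of the `i`-th edge of each
cycle. -/
def witnessGraph : SimpleGraph WitnessVertex :=
  SimpleGraph.fromRel WitnessRel

/-! Cycle vertices keep their positions in all frames, so constraints obtained in different frames
apply to the same points. Intervals that meet pairwise share a time step, so overlap of visible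
intervals yields one frame to which plane geometry applies.

Timing: if all apex vertices overlapped pairwise, some frame would show four of them with three
consecutive vertices of a cycle, against `false_of_four_common_neighbours`. So some apex vertex
vanishes before another appears, and every cycle vertex, adjacent to both, spans the gap. Hence all
cycle vertices overlap, and then no two apex vertices do, by `false_of_two_apices`. The apex
vertices are thus linearly ordered in time, and each one strictly between the earliest and the
latest is visible only while the whole of all three cycles is.

Geometry: for such an apex vertex `q` of index `i`, in a frame with its edge vertex, at least two of
the three cycles lie inside the triangle over their `i`-th side with corner `q`
(`IsStraightDrawing.cycle_subset_triangle`). Two copies `j` suffice to find such apex vertices for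
some `i` and also for `i + 2`; two cycles out of three, taken twice, share one. That quadrilateral
lies in a triangle over each of two opposite sides, which makes its other two sides meet
(`not_disjoint_of_opposite_triangles`).

Curves escape this obstruction by bending around the cycles: an explicit polygonal drawing with at
most one bend per edge is checked by integer arithmetic. -/

/-! ### Triangles and crossing segments in barycentric coordinates. -/

/-- Twice the signed area of the triangle `p q r`. -/
def signedArea (p q r : Plane) : ℝ :=
  (q 0 - p 0) * (r 1 - p 1) - (q 1 - p 1) * (r 0 - p 0)

/-- The point `p` lies in the closed triangle `a b c`. -/
def InTriangle (p a b c : Plane) : Prop :=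
  ∃ α β γ : ℝ, 0 ≤ α ∧ 0 ≤ β ∧ 0 ≤ γ ∧ α + β + γ = 1 ∧
    p 0 = α * a 0 + β * b 0 + γ * c 0 ∧ p 1 = α * a 1 + β * b 1 + γ * c 1

theorem plane_ext {p q : Plane} (h0 : p 0 = q 0) (h1 : p 1 = q 1) : p = q := by
  ext i; fin_cases i
  · exact h0
  · exact h1

theorem InTriangle.rotate {p a b c : Plane} (h : InTriangle p a b c) : InTriangle p b c a := by
  obtain ⟨α, β, γ, h1, h2, h3, h4, h5, h6⟩ := h
  exact ⟨β, γ, α, h2, h3, h1, by linarith, by linarith, by linarith⟩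

theorem InTriangle.swap {p a b c : Plane} (h : InTriangle p a b c) : InTriangle p b a c := by
  obtain ⟨α, β, γ, h1, h2, h3, h4, h5, h6⟩ := h
  exact ⟨β, α, γ, h2, h1, h3, by linarith, by linarith, by linarith⟩

theorem inTriangle_left (a b c : Plane) : InTriangle a a b c :=
  ⟨1, 0, 0, by norm_num, le_rfl, le_rfl, by norm_num, by ring, by ring⟩

theorem mem_segment_coord {a b x : Plane} :
    x ∈ segment ℝ a b ↔ ∃ s t : ℝ, 0 ≤ s ∧ 0 ≤ t ∧ s + t = 1 ∧
      x 0 = s * a 0 + t * b 0 ∧ x 1 = s * a 1 + t * b 1 := by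
  constructor
  · rintro ⟨s, t, hs, ht, hst, rfl⟩
    exact ⟨s, t, hs, ht, hst, by simp, by simp⟩
  · rintro ⟨s, t, hs, ht, hst, h0, h1⟩
    exact ⟨s, t, hs, ht, hst, plane_ext (by simp [h0]) (by simp [h1])⟩

/-- The weights are not normalised, so a barycentric relation with its negative terms moved to the
other side yields a crossing directly. -/
theorem not_disjoint_segment {a b c d : Plane} {s t u v : ℝ} (hs : 0 ≤ s) (ht : 0 ≤ t)
    (hu : 0 ≤ u) (hv : 0 ≤ v) (hpos : 0 < s + t) (hsum : s + t = u + v)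
    (h0 : s * a 0 + t * b 0 = u * c 0 + v * d 0) (h1 : s * a 1 + t * b 1 = u * c 1 + v * d 1) :
    ¬ Disjoint (segment ℝ a b) (segment ℝ c d) := by
  rw [Set.not_disjoint_iff]
  have hne : s + t ≠ 0 := hpos.ne'
  have hne' : u + v ≠ 0 := hsum ▸ hne
  refine ⟨(s / (s + t)) • a + (t / (s + t)) • b,
    ⟨_, _, by positivity, by positivity, by field_simp, rfl⟩,
    ⟨u / (s + t), v / (s + t), by positivity, by positivity, by rw [hsum]; field_simp, ?_⟩⟩
  refine plane_ext ?_ ?_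
  · simp only [PiLp.add_apply, PiLp.smul_apply, smul_eq_mul]
    field_simp; linarith
  · simp only [PiLp.add_apply, PiLp.smul_apply, smul_eq_mul]
    field_simp; linarith

theorem exists_barycentric {a b c : Plane} (h : signedArea a b c ≠ 0) (p : Plane) :
    ∃ α β γ : ℝ, α + β + γ = 1 ∧
      p 0 = α * a 0 + β * b 0 + γ * c 0 ∧ p 1 = α * a 1 + β * b 1 + γ * c 1 := by
  refine ⟨signedArea p b c / signedArea a b c, signedArea a p c / signedArea a b c,
    signedArea a b p / signedArea a b c, ?_, ?_, ?_⟩ <;>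
  · field_simp
    simp only [signedArea]; ring

theorem signedArea_combination {a b c p : Plane} {α β γ : ℝ} (hsum : α + β + γ = 1)
    (h0 : p 0 = α * a 0 + β * b 0 + γ * c 0) (h1 : p 1 = α * a 1 + β * b 1 + γ * c 1) :
    signedArea p b c = α * signedArea a b c ∧ signedArea a p c = β * signedArea a b c ∧
      signedArea a b p = γ * signedArea a b c := by
  obtain rfl : α = 1 - β - γ := by linarith
  simp only [signedArea, h0, h1]
  refine ⟨?_, ?_, ?_⟩ <;> ring

theorem barycentric_unique {a b c : Plane} (h : signedArea a b c ≠ 0) {α β γ α' β' γ' : ℝ}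
    (hsum : α + β + γ = 1) (hsum' : α' + β' + γ' = 1)
    (h0 : α * a 0 + β * b 0 + γ * c 0 = α' * a 0 + β' * b 0 + γ' * c 0)
    (h1 : α * a 1 + β * b 1 + γ * c 1 = α' * a 1 + β' * b 1 + γ' * c 1) :
    α = α' ∧ β = β' ∧ γ = γ' := by
  let p : Plane := !₂[α * a 0 + β * b 0 + γ * c 0, α * a 1 + β * b 1 + γ * c 1]
  obtain ⟨e1, e2, e3⟩ := signedArea_combination (a := a) (b := b) (c := c) (p := p)
    hsum (by simp [p]) (by simp [p])
  obtain ⟨f1, f2, f3⟩ := signedArea_combination (a := a) (b := b) (c := c) (p := p)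
    hsum' (by simp [p, h0]) (by simp [p, h1])
  exact ⟨mul_right_cancel₀ h (e1 ▸ f1), mul_right_cancel₀ h (e2 ▸ f2),
    mul_right_cancel₀ h (e3 ▸ f3)⟩

/-- In coordinates with respect to `q a b`, the common side makes the weight of `q` in `p` positive.
If the weights of `a` and `b` have opposite signs, moving the negative one across exhibits a
crossing; otherwise one of the two triangles contains the other. -/
theorem inTriangle_or_inTriangle {a b p q : Plane}
    (hside : 0 < signedArea a b p * signedArea a b q)
    (h1 : Disjoint (segment ℝ p a) (segment ℝ q b))
    (h2 : Disjoint (segment ℝ p b) (segment ℝ q a)) :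
    InTriangle p q a b ∨ InTriangle q p a b := by
  have hq : signedArea q a b ≠ 0 := by
    intro h
    have : signedArea a b q = signedArea q a b := by simp only [signedArea]; ring
    rw [this, h] at hside; simp at hside
  obtain ⟨α, β, γ, hs, e0, e1⟩ := exists_barycentric hq p
  have hα : 0 < α := by
    obtain ⟨h, -, -⟩ := signedArea_combination hs e0 e1
    have e3 : signedArea a b q = signedArea q a b := by simp only [signedArea]; ring
    have e4 : signedArea a b p = signedArea p a b := by simp only [signedArea]; ring
    rw [e3, e4, h] at hside
    by_contra hc
    nlinarith [mul_self_nonneg (signedArea q a b)]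
  rcases le_or_gt 0 β with hβ | hβ <;> rcases le_or_gt 0 γ with hγ | hγ
  · exact .inl ⟨α, β, γ, hα.le, hβ, hγ, hs, e0, e1⟩
  · exact absurd h2 (not_disjoint_segment (s := 1) (t := -γ) (u := α) (v := β) zero_le_one
      (by linarith) hα.le hβ (by linarith) (by linarith) (by linarith) (by linarith))
  · exact absurd h1 (not_disjoint_segment (s := 1) (t := -β) (u := α) (v := γ) zero_le_one
      (by linarith) hα.le hγ (by linarith) (by linarith) (by linarith) (by linarith))
  · refine .inr ⟨1 / α, -β / α, -γ / α, by positivity, div_nonneg (by linarith) hα.le,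
      div_nonneg (by linarith) hα.le, ?_, ?_, ?_⟩
    · field_simp; linarith
    · field_simp; linarith
    · field_simp; linarith

/-- Along the segment from `v` to `w` the least barycentric coordinate varies continuously. Were `w`
outside, it would vanish somewhere, at a point on a side of the triangle. -/
theorem inTriangle_of_disjoint_sides {a b c v w : Plane} (h : signedArea a b c ≠ 0)
    (hab : Disjoint (segment ℝ v w) (segment ℝ a b))
    (hbc : Disjoint (segment ℝ v w) (segment ℝ b c))
    (hca : Disjoint (segment ℝ v w) (segment ℝ c a)) (hv : InTriangle v a b c) :
    InTriangle w a b c := by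
  obtain ⟨α, β, γ, hα, hβ, hγ, hs, e0, e1⟩ := hv
  obtain ⟨α', β', γ', hs', e0', e1'⟩ := exists_barycentric h w
  by_contra hw
  let f : ℝ → ℝ := fun t => min ((1 - t) * α + t * α')
    (min ((1 - t) * β + t * β') ((1 - t) * γ + t * γ'))
  have hf : Continuous f := by fun_prop
  have hf0 : 0 ≤ f 0 := by simp [f, *]
  have hf1 : f 1 ≤ 0 := by
    by_contra hc
    simp only [f, not_le, lt_min_iff, sub_self, zero_mul, one_mul, zero_add] at hc
    exact hw ⟨α', β', γ', hc.1.le, hc.2.1.le, hc.2.2.le, hs', e0', e1'⟩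
  obtain ⟨t, ⟨ht0, ht1⟩, ht⟩ := intermediate_value_Icc' zero_le_one hf.continuousOn ⟨hf1, hf0⟩
  have h1 : 0 ≤ (1 - t) * α + t * α' := ht ▸ min_le_left _ _
  have h2 : 0 ≤ (1 - t) * β + t * β' := ht ▸ (min_le_right _ _).trans (min_le_left _ _)
  have h3 : 0 ≤ (1 - t) * γ + t * γ' := ht ▸ (min_le_right _ _).trans (min_le_right _ _)
  have key0 : (1 - t) * v 0 + t * w 0 = ((1 - t) * α + t * α') * a 0 +
      ((1 - t) * β + t * β') * b 0 + ((1 - t) * γ + t * γ') * c 0 := by rw [e0, e0']; ring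
  have key1 : (1 - t) * v 1 + t * w 1 = ((1 - t) * α + t * α') * a 1 +
      ((1 - t) * β + t * β') * b 1 + ((1 - t) * γ + t * γ') * c 1 := by rw [e1, e1']; ring
  have hsum : ((1 - t) * α + t * α') + ((1 - t) * β + t * β') + ((1 - t) * γ + t * γ') = 1 := by
    linear_combination (1 - t) * hs + t * hs'
  have ht : min ((1 - t) * α + t * α') (min ((1 - t) * β + t * β') ((1 - t) * γ + t * γ')) = 0 := ht
  generalize (1 - t) * α + t * α' = x at *
  generalize (1 - t) * β + t * β' = y at *
  generalize (1 - t) * γ + t * γ' = z at *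
  have hzero : x = 0 ∨ y = 0 ∨ z = 0 := by
    rcases min_choice x (min y z) with hm | hm
    · exact .inl (hm ▸ ht)
    · rcases min_choice y z with hm' | hm'
      · exact .inr (.inl (by rw [hm, hm'] at ht; exact ht))
      · exact .inr (.inr (by rw [hm, hm'] at ht; exact ht))
  rcases hzero with rfl | rfl | rfl
  · exact not_disjoint_segment (s := 1 - t) (t := t) (u := y) (v := z) (by linarith) ht0 h2 h3
      (by linarith) (by linarith) (by linarith) (by linarith) hbc
  · exact not_disjoint_segment (s := 1 - t) (t := t) (u := z) (v := x) (by linarith) ht0 h3 h1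
      (by linarith) (by linarith) (by linarith) (by linarith) hca
  · exact not_disjoint_segment (s := 1 - t) (t := t) (u := x) (v := y) (by linarith) ht0 h1 h2
      (by linarith) (by linarith) (by linarith) (by linarith) hab

/-- A corner of a nondegenerate triangle is an extreme point of it. -/
theorem not_inTriangle_of_inTriangle {a b c p₁ p₂ p₃ : Plane} (h : signedArea a b c ≠ 0)
    (h1 : InTriangle p₁ a b c) (h2 : InTriangle p₂ a b c) (h3 : InTriangle p₃ a b c)
    (n1 : p₁ ≠ a) (n2 : p₂ ≠ a) (n3 : p₃ ≠ a) : ¬ InTriangle a p₁ p₂ p₃ := by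
  rintro ⟨s, t, u, hs, ht, hu, hsum, e0, e1⟩
  have coord_lt : ∀ {α β γ : ℝ} {p : Plane}, 0 ≤ β → 0 ≤ γ → α + β + γ = 1 →
      p 0 = α * a 0 + β * b 0 + γ * c 0 → p 1 = α * a 1 + β * b 1 + γ * c 1 → p ≠ a → α < 1 := by
    intro α β γ p hβ hγ hsum h0 h1 hne
    by_contra hc
    obtain rfl : β = 0 := by linarith
    obtain rfl : γ = 0 := by linarith
    obtain rfl : α = 1 := by linarith
    exact hne (plane_ext (by simpa using h0) (by simpa using h1))
  obtain ⟨α₁, β₁, γ₁, -, b1, c1, s1, x1, y1⟩ := h1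
  obtain ⟨α₂, β₂, γ₂, -, b2, c2, s2, x2, y2⟩ := h2
  obtain ⟨α₃, β₃, γ₃, -, b3, c3, s3, x3, y3⟩ := h3
  have l1 := coord_lt b1 c1 s1 x1 y1 n1
  have l2 := coord_lt b2 c2 s2 x2 y2 n2
  have l3 := coord_lt b3 c3 s3 x3 y3 n3
  -- The weight at the corner `a` is 1 for `a` itself but less than 1 for each `pᵢ`, hence for every
  -- convex combination of them.
  obtain ⟨hα, -, -⟩ := barycentric_unique h (α := 1) (β := 0) (γ := 0)
    (α' := s * α₁ + t * α₂ + u * α₃) (β' := s * β₁ + t * β₂ + u * β₃)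
    (γ' := s * γ₁ + t * γ₂ + u * γ₃) (by norm_num)
    (by linear_combination s * s1 + t * s2 + u * s3 + hsum)
    (by rw [x1, x2, x3] at e0; linear_combination e0)
    (by rw [y1, y2, y3] at e1; linear_combination e1)
  rcases hs.eq_or_lt with rfl | hs
  · rcases ht.eq_or_lt with rfl | ht
    · nlinarith
    · nlinarith
  · nlinarith

/-- The corner to replace by `m` is the one where the ratio of the weight of `g` to that of `m` is
least. Ratios are compared as products because `m` may lie on a side. -/
theorem InTriangle.cover {a b c m g : Plane} (hm : InTriangle m a b c) (hg : InTriangle g a b c) :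
    InTriangle g m b c ∨ InTriangle g a m c ∨ InTriangle g a b m := by
  obtain ⟨α, β, γ, hα, hβ, hγ, hs, e0, e1⟩ := hm
  obtain ⟨x, y, z, hx, hy, hz, hs', f0, f1⟩ := hg
  have first : ∀ {α β γ x y z : ℝ} {a b c : Plane}, 0 < α → 0 ≤ β → 0 ≤ γ → 0 ≤ x →
      α + β + γ = 1 → x + y + z = 1 →
      m 0 = α * a 0 + β * b 0 + γ * c 0 → m 1 = α * a 1 + β * b 1 + γ * c 1 →
      g 0 = x * a 0 + y * b 0 + z * c 0 → g 1 = x * a 1 + y * b 1 + z * c 1 →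
      x * β ≤ y * α → x * γ ≤ z * α → InTriangle g m b c := by
    intro α β γ x y z a b c hα hβ hγ hx hs hs' e0 e1 f0 f1 h1 h2
    refine ⟨x / α, y - x * β / α, z - x * γ / α, by positivity, ?_, ?_, ?_, ?_, ?_⟩
    · rw [sub_nonneg, div_le_iff₀ hα]; exact h1
    · rw [sub_nonneg, div_le_iff₀ hα]; exact h2
    · field_simp; linear_combination α * hs' - x * hs
    · rw [e0, f0]; field_simp; ring
    · rw [e1, f1]; field_simp; ring
  have A : 0 < α → x * β ≤ y * α → x * γ ≤ z * α → InTriangle g m b c := fun h h1 h2 =>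
    first h hβ hγ hx hs hs' e0 e1 f0 f1 h1 h2
  have B : 0 < β → y * α ≤ x * β → y * γ ≤ z * β → InTriangle g a m c := fun h h1 h2 =>
    (first (a := b) (b := a) (c := c) h hα hγ hy (by linarith) (by linarith) (by linarith)
      (by linarith) (by linarith) (by linarith) h1 h2).swap
  have C : 0 < γ → z * α ≤ x * γ → z * β ≤ y * γ → InTriangle g a b m := fun h h1 h2 =>
    (first (a := c) (b := a) (c := b) h hα hβ hz (by linarith) (by linarith) (by linarith)
      (by linarith) (by linarith) (by linarith) h1 h2).rotate
  rcases hα.eq_or_lt with rfl | hα'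
  · rcases hβ.eq_or_lt with rfl | hβ'
    · exact .inr (.inr (C (by linarith) (by nlinarith) (by nlinarith)))
    · rcases le_or_gt (y * γ) (z * β) with h | h
      · exact .inr (.inl (B hβ' (by nlinarith) h))
      · exact .inr (.inr (C (hγ.lt_of_ne (by rintro rfl; nlinarith)) (by nlinarith) h.le))
  rcases hβ.eq_or_lt with rfl | hβ'
  · rcases le_or_gt (x * γ) (z * α) with h | h
    · exact .inl (A hα' (by nlinarith) h)
    · exact .inr (.inr (C (hγ.lt_of_ne (by rintro rfl; nlinarith)) h.le (by nlinarith)))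
  rcases hγ.eq_or_lt with rfl | hγ'
  · rcases le_total (x * β) (y * α) with h | h
    · exact .inl (A hα' h (by nlinarith))
    · exact .inr (.inl (B hβ' h (by nlinarith)))
  rcases le_total (x * β) (y * α) with hab | hab
  · rcases le_total (x * γ) (z * α) with hac | hac
    · exact .inl (A hα' hab hac)
    · refine .inr (.inr (C hγ' hac (le_of_mul_le_mul_right ?_ hα')))
      nlinarith [mul_le_mul_of_nonneg_right hab hγ, mul_le_mul_of_nonneg_right hac hβ]
  · rcases le_total (y * γ) (z * β) with hbc | hbc
    · exact .inr (.inl (B hβ' hab hbc))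
    · refine .inr (.inr (C hγ' (le_of_mul_le_mul_right ?_ hβ') hbc))
      nlinarith [mul_le_mul_of_nonneg_right hab hγ, mul_le_mul_of_nonneg_right hbc hα]

/-- Four points spanning a crossing-free straight-line `K₄` are not in convex position. -/
theorem inTriangle_of_disjoint_segments {a b c d : Plane} (habc : signedArea a b c ≠ 0)
    (hbcd : signedArea d b c ≠ 0) (hacd : signedArea a d c ≠ 0) (habd : signedArea a b d ≠ 0)
    (h1 : Disjoint (segment ℝ a b) (segment ℝ c d)) (h2 : Disjoint (segment ℝ a c) (segment ℝ b d))
    (h3 : Disjoint (segment ℝ a d) (segment ℝ b c)) :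
    InTriangle d a b c ∨ InTriangle a d b c ∨ InTriangle b a d c ∨ InTriangle c a b d := by
  obtain ⟨α, β, γ, hs, e0, e1⟩ := exists_barycentric habc d
  obtain ⟨ea, eb, ec⟩ := signedArea_combination hs e0 e1
  have ha : α ≠ 0 := by rintro rfl; simp at ea; exact hbcd ea
  have hb : β ≠ 0 := by rintro rfl; simp at eb; exact hacd eb
  have hc : γ ≠ 0 := by rintro rfl; simp at ec; exact habd ec
  -- Three positive weights put `d` inside, exactly one positive weight puts that corner inside the
  -- triangle of the others, and exactly one negative weight gives a crossing.
  rcases ha.lt_or_gt with ha | ha <;> rcases hb.lt_or_gt with hb | hb <;>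
    rcases hc.lt_or_gt with hc | hc
  · linarith
  · refine .inr (.inr (.inr ⟨-α / γ, -β / γ, 1 / γ, ?_, ?_, by positivity, ?_, ?_, ?_⟩))
    · exact div_nonneg (by linarith) hc.le
    · exact div_nonneg (by linarith) hc.le
    all_goals field_simp; linarith
  · refine .inr (.inr (.inl ⟨-α / β, 1 / β, -γ / β, ?_, by positivity, ?_, ?_, ?_, ?_⟩))
    · exact div_nonneg (by linarith) hb.le
    · exact div_nonneg (by linarith) hb.le
    all_goals field_simp; linarith
  · exact absurd h3 (not_disjoint_segment (s := -α) (t := 1) (u := β) (v := γ) (by linarith)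
      (by linarith) hb.le hc.le (by linarith) (by linarith) (by linarith) (by linarith))
  · refine .inr (.inl ⟨1 / α, -β / α, -γ / α, by positivity, ?_, ?_, ?_, ?_, ?_⟩)
    · exact div_nonneg (by linarith) ha.le
    · exact div_nonneg (by linarith) ha.le
    all_goals field_simp; linarith
  · exact absurd h2 (not_disjoint_segment (s := α) (t := γ) (u := -β) (v := 1) ha.le hc.le
      (by linarith) (by linarith) (by linarith) (by linarith) (by linarith) (by linarith))
  · exact absurd h1 (not_disjoint_segment (s := α) (t := β) (u := -γ) (v := 1) ha.le hb.le
      (by linarith) (by linarith) (by linarith) (by linarith) (by linarith) (by linarith))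
  · exact .inl ⟨α, β, γ, ha.le, hb.le, hc.le, hs, e0, e1⟩

theorem mem_segment_of_signedArea_eq_zero {a b c : Plane} (h : signedArea a b c = 0) :
    a ∈ segment ℝ b c ∨ b ∈ segment ℝ a c ∨ c ∈ segment ℝ a b := by
  have hcol : Collinear ℝ ({a, b, c} : Set Plane) := by
    by_cases hab : b = a
    · subst hab; simpa using collinear_pair ℝ b c
    rw [collinear_iff_of_mem (p₀ := a) (by simp)]
    refine ⟨b - a, ?_⟩
    have hne : (b 0 - a 0) * (b 0 - a 0) + (b 1 - a 1) * (b 1 - a 1) ≠ 0 := by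
      intro hz
      exact hab (plane_ext (by nlinarith [mul_self_nonneg (b 0 - a 0), mul_self_nonneg (b 1 - a 1)])
        (by nlinarith [mul_self_nonneg (b 0 - a 0), mul_self_nonneg (b 1 - a 1)]))
    obtain ⟨t, ht⟩ : ∃ t, t * ((b 0 - a 0) * (b 0 - a 0) + (b 1 - a 1) * (b 1 - a 1)) =
        (b 0 - a 0) * (c 0 - a 0) + (b 1 - a 1) * (c 1 - a 1) := ⟨_, div_mul_cancel₀ _ hne⟩
    simp only [Set.mem_insert_iff, Set.mem_singleton_iff, forall_eq_or_imp, forall_eq]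
    refine ⟨⟨0, by simp⟩, ⟨1, by simp⟩, ⟨t, ?_⟩⟩
    simp only [signedArea] at h
    refine plane_ext ?_ ?_
    · simp only [vadd_eq_add, PiLp.add_apply, PiLp.smul_apply, PiLp.sub_apply, smul_eq_mul]
      refine mul_left_cancel₀ hne ?_
      linear_combination -(b 1 - a 1) * h - (b 0 - a 0) * ht
    · simp only [vadd_eq_add, PiLp.add_apply, PiLp.smul_apply, PiLp.sub_apply, smul_eq_mul]
      refine mul_left_cancel₀ hne ?_
      linear_combination (b 0 - a 0) * h - (b 1 - a 1) * ht
  rcases hcol.wbtw_or_wbtw_or_wbtw with hw | hw | hw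
  · exact .inr (.inl (mem_segment_iff_wbtw.2 hw))
  · exact .inr (.inr (mem_segment_iff_wbtw.2 hw.symm))
  · exact .inl (mem_segment_iff_wbtw.2 hw.symm)

/-- Two opposite sides of a quadrilateral cannot both be the base of a triangle which contains the
quadrilateral, unless the other two sides meet. -/
theorem not_disjoint_of_opposite_triangles {x₁ x₂ x₃ x₄ q q' : Plane}
    (h123 : signedArea x₁ x₂ x₃ ≠ 0) (h124 : signedArea x₁ x₂ x₄ ≠ 0)
    (h341 : signedArea x₃ x₄ x₁ ≠ 0) (h342 : signedArea x₃ x₄ x₂ ≠ 0)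
    (h3 : InTriangle x₃ q x₁ x₂) (h4 : InTriangle x₄ q x₁ x₂)
    (h1 : InTriangle x₁ q' x₃ x₄) (h2 : InTriangle x₂ q' x₃ x₄) :
    ¬ Disjoint (segment ℝ x₁ x₄) (segment ℝ x₂ x₃) := by
  -- The second product says that the sides from `x₁` to `x₄` and from `x₂` to `x₃` lean towards
  -- each other as they leave the base. Used from both bases, it gives the two pairs of areas
  -- opposite signs.
  have key : ∀ {x₁ x₂ x₃ x₄ q : Plane}, signedArea x₁ x₂ x₃ ≠ 0 → signedArea x₁ x₂ x₄ ≠ 0 →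
      InTriangle x₃ q x₁ x₂ → InTriangle x₄ q x₁ x₂ →
      0 < signedArea x₁ x₂ x₃ * signedArea x₁ x₂ x₄ ∧
      0 < signedArea x₁ x₂ x₃ *
        ((x₄ 0 - x₁ 0) * (x₃ 1 - x₂ 1) - (x₄ 1 - x₁ 1) * (x₃ 0 - x₂ 0)) := by
    rintro x₁ x₂ x₃ x₄ q h123 h124 ⟨α, β, γ, hα, hβ, hγ, hs, e0, e1⟩
      ⟨α', β', γ', hα', hβ', hγ', hs', e0', e1'⟩
    have a3 : signedArea x₁ x₂ x₃ = α * signedArea x₁ x₂ q := by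
      obtain rfl : α = 1 - β - γ := by linarith
      simp only [signedArea, e0, e1]; ring
    have a4 : signedArea x₁ x₂ x₄ = α' * signedArea x₁ x₂ q := by
      obtain rfl : α' = 1 - β' - γ' := by linarith
      simp only [signedArea, e0', e1']; ring
    have c : (x₄ 0 - x₁ 0) * (x₃ 1 - x₂ 1) - (x₄ 1 - x₁ 1) * (x₃ 0 - x₂ 0) =
        (α' * α + α' * β + γ' * α) * signedArea x₁ x₂ q := by
      obtain rfl : γ = 1 - α - β := by linarith
      obtain rfl : β' = 1 - α' - γ' := by linarith
      simp only [signedArea, e0, e1, e0', e1']; ring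
    have hα0 : α ≠ 0 := by rintro rfl; simp [a3] at h123
    have hα0' : α' ≠ 0 := by rintro rfl; simp [a4] at h124
    have hq : signedArea x₁ x₂ q ≠ 0 := by intro h; simp [a3, h] at h123
    have hαp : 0 < α := lt_of_le_of_ne hα hα0.symm
    have hαp' : 0 < α' := lt_of_le_of_ne hα' hα0'.symm
    have hqq : 0 < signedArea x₁ x₂ q * signedArea x₁ x₂ q := mul_self_pos.2 hq
    rw [a3, a4, c]
    constructor
    · nlinarith [mul_pos (mul_pos hαp hαp') hqq]
    · have : 0 < α' * α + α' * β + γ' * α := by positivity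
      nlinarith [mul_pos (mul_pos hαp this) hqq]
  obtain ⟨k1, k2⟩ := key h123 h124 h3 h4
  obtain ⟨k3, k4⟩ := key h341 h342 h1 h2
  set m := (x₄ 0 - x₁ 0) * (x₃ 1 - x₂ 1) - (x₄ 1 - x₁ 1) * (x₃ 0 - x₂ 0) with hm
  have hm' : (x₂ 0 - x₃ 0) * (x₁ 1 - x₄ 1) - (x₂ 1 - x₃ 1) * (x₁ 0 - x₄ 0) = -m := by
    rw [hm]; ring
  rw [hm'] at k4
  -- The affine dependence of four points, each weighted by the area of the other three. The signs
  -- found above turn it into a common point of the two sides.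
  have s1 : signedArea x₁ x₂ x₃ - signedArea x₁ x₂ x₄ =
      signedArea x₃ x₄ x₂ - signedArea x₃ x₄ x₁ := by simp only [signedArea]; ring
  have z0 : -signedArea x₃ x₄ x₂ * x₁ 0 + signedArea x₁ x₂ x₃ * x₄ 0 =
      -signedArea x₃ x₄ x₁ * x₂ 0 + signedArea x₁ x₂ x₄ * x₃ 0 := by simp only [signedArea]; ring
  have z1 : -signedArea x₃ x₄ x₂ * x₁ 1 + signedArea x₁ x₂ x₃ * x₄ 1 =
      -signedArea x₃ x₄ x₁ * x₂ 1 + signedArea x₁ x₂ x₄ * x₃ 1 := by simp only [signedArea]; ring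
  generalize signedArea x₁ x₂ x₃ = p at *
  generalize signedArea x₁ x₂ x₄ = p' at *
  generalize signedArea x₃ x₄ x₁ = r at *
  generalize signedArea x₃ x₄ x₂ = r' at *
  rcases h123.lt_or_gt with hp | hp
  · have hm0 : m < 0 := by by_contra hc; nlinarith
    have hr : 0 < r := by by_contra hc; nlinarith
    have hp' : p' < 0 := by by_contra hc; nlinarith
    have hr' : 0 < r' := by by_contra hc; nlinarith
    exact not_disjoint_segment (s := r') (t := -p) (u := r) (v := -p') (by linarith) (by linarith)
      (by linarith) (by linarith) (by linarith) (by linarith) (by linarith) (by linarith)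
  · have hm0 : 0 < m := by by_contra hc; nlinarith
    have hr : r < 0 := by by_contra hc; nlinarith
    have hp' : 0 < p' := by by_contra hc; nlinarith
    have hr' : r' < 0 := by by_contra hc; nlinarith
    exact not_disjoint_segment (s := -r') (t := p) (u := -r) (v := p') (by linarith) (by linarith)
      (by linarith) (by linarith) (by linarith) (by linarith) (by linarith) (by linarith)

/-! ### Obstructions to crossing-free straight-line drawings. -/

/-- The vertex positions `pos` define a crossing-free straight-line drawing of `H`. -/
structure IsStraightDrawing {U : Type*} (H : SimpleGraph U) (pos : U → Plane) : Prop where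
  injective : Function.Injective pos
  eq_or_eq : ∀ u v w, H.Adj u v → pos w ∈ segment ℝ (pos u) (pos v) → w = u ∨ w = v
  disjoint : ∀ u v u' v', H.Adj u v → H.Adj u' v' → u ≠ u' → u ≠ v' → v ≠ u' → v ≠ v' →
    Disjoint (segment ℝ (pos u) (pos v)) (segment ℝ (pos u') (pos v'))

/-- Three disjoint four-cycles in `H`. -/
structure IsCycleTriple {U : Type*} (H : SimpleGraph U) (x : Fin 3 → Fin 4 → U) : Prop where
  adj : ∀ c k, H.Adj (x c k) (x c (k + 1))
  inj : ∀ c k c' k', x c k = x c' k' → c = c' ∧ k = k'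

namespace IsStraightDrawing

variable {U : Type*} {H : SimpleGraph U} {pos : U → Plane}

theorem signedArea_ne_zero (D : IsStraightDrawing H pos) {u v w : U} (huv : H.Adj u v)
    (hvw : H.Adj v w) (huw : H.Adj u w) : signedArea (pos u) (pos v) (pos w) ≠ 0 := by
  intro h
  rcases mem_segment_of_signedArea_eq_zero h with h | h | h
  · rcases D.eq_or_eq _ _ _ hvw h with h | h
    · exact huv.ne h
    · exact huw.ne h
  · rcases D.eq_or_eq _ _ _ huw h with h | h
    · exact huv.ne h.symm
    · exact hvw.ne h
  · rcases D.eq_or_eq _ _ _ huv h with h | h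
    · exact huw.ne h.symm
    · exact hvw.ne h.symm

/-- Adjacent vertices off a triangle of the graph lie on the same side of it. -/
theorem inTriangle_iff (D : IsStraightDrawing H pos) {u v w a b : U} (huv : H.Adj u v)
    (hvw : H.Adj v w) (huw : H.Adj u w) (hab : H.Adj a b) (hau : a ≠ u) (hav : a ≠ v)
    (haw : a ≠ w) (hbu : b ≠ u) (hbv : b ≠ v) (hbw : b ≠ w) :
    InTriangle (pos a) (pos u) (pos v) (pos w) ↔ InTriangle (pos b) (pos u) (pos v) (pos w) :=
  ⟨inTriangle_of_disjoint_sides (D.signedArea_ne_zero huv hvw huw)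
    (D.disjoint _ _ _ _ hab huv hau hav hbu hbv) (D.disjoint _ _ _ _ hab hvw hav haw hbv hbw)
    (D.disjoint _ _ _ _ hab huw.symm haw hau hbw hbu),
  inTriangle_of_disjoint_sides (D.signedArea_ne_zero huv hvw huw)
    (D.disjoint _ _ _ _ hab.symm huv hbu hbv hau hav)
    (D.disjoint _ _ _ _ hab.symm hvw hbv hbw hav haw)
    (D.disjoint _ _ _ _ hab.symm huw.symm hbw hbu haw hau)⟩

theorem not_inTriangle (D : IsStraightDrawing H pos) {u v w p₁ p₂ p₃ : U} (huv : H.Adj u v)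
    (hvw : H.Adj v w) (huw : H.Adj u w)
    (h1 : InTriangle (pos p₁) (pos u) (pos v) (pos w))
    (h2 : InTriangle (pos p₂) (pos u) (pos v) (pos w))
    (h3 : InTriangle (pos p₃) (pos u) (pos v) (pos w))
    (n1 : p₁ ≠ u) (n2 : p₂ ≠ u) (n3 : p₃ ≠ u) :
    ¬ InTriangle (pos u) (pos p₁) (pos p₂) (pos p₃) :=
  not_inTriangle_of_inTriangle (D.signedArea_ne_zero huv hvw huw) h1 h2 h3
    (D.injective.ne n1) (D.injective.ne n2) (D.injective.ne n3)

/-- No crossing-free straight-line drawing has an edge `a b` and a vertex `c` with four common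
neighbours of `a`, `b` and `c`. -/
theorem false_of_four_common_neighbours (D : IsStraightDrawing H pos) {a b c : U} {q : Fin 4 → U}
    (hq : Function.Injective q) (hab : H.Adj a b) (hca : c ≠ a) (hcb : c ≠ b)
    (hqa : ∀ i, H.Adj (q i) a) (hqb : ∀ i, H.Adj (q i) b) (hqc : ∀ i, H.Adj (q i) c) : False := by
  -- As `c` is adjacent to every `q j`, one triangle `q i, a, b` contains `c` together with all
  -- other `q j` or with none. Containing `c` for two indices would put each triangle's corner
  -- inside the other.
  have status : ∀ i j, i ≠ j → (InTriangle (pos (q j)) (pos (q i)) (pos a) (pos b) ↔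
      InTriangle (pos c) (pos (q i)) (pos a) (pos b)) := fun i j hij =>
    D.inTriangle_iff (hqa i) hab (hqb i) (hqc j) (hq.ne hij.symm) (hqa j).ne (hqb j).ne
      (hqc i).ne' hca hcb
  have once : ∀ i j, i ≠ j → InTriangle (pos c) (pos (q i)) (pos a) (pos b) →
      InTriangle (pos c) (pos (q j)) (pos a) (pos b) → False := by
    intro i j hij hi hj
    rw [← status i j hij] at hi
    rw [← status j i hij.symm] at hj
    exact D.not_inTriangle (hqa i) hab (hqb i) hi (inTriangle_left _ _ _).swap
      (inTriangle_left _ _ _).rotate (hq.ne hij.symm) (hqa i).ne' (hqb i).ne' hj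
  -- Triangles on the same side of `a b` would be nested. So at most two of them, one per side,
  -- avoid `c`, and at most one contains it: too few for four.
  have sides : ∀ i j, i ≠ j → ¬ InTriangle (pos c) (pos (q i)) (pos a) (pos b) →
      ¬ InTriangle (pos c) (pos (q j)) (pos a) (pos b) →
      signedArea (pos a) (pos b) (pos (q i)) * signedArea (pos a) (pos b) (pos (q j)) ≤ 0 := by
    intro i j hij hi hj
    rw [← status i j hij] at hi
    rw [← status j i hij.symm] at hj
    by_contra hc
    rcases inTriangle_or_inTriangle (not_le.1 hc)
      (D.disjoint _ _ _ _ (hqa i) (hqb j) (hq.ne hij) (hqb i).ne (hqa j).ne' hab.ne)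
      (D.disjoint _ _ _ _ (hqb i) (hqa j) (hq.ne hij) (hqa i).ne (hqb j).ne' hab.ne') with h | h
    · exact hj h
    · exact hi h
  have hne : ∀ i, signedArea (pos a) (pos b) (pos (q i)) ≠ 0 := fun i =>
    D.signedArea_ne_zero hab (hqb i).symm (hqa i).symm
  have three : ∀ i j k, i ≠ j → i ≠ k → j ≠ k →
      ¬ InTriangle (pos c) (pos (q i)) (pos a) (pos b) →
      ¬ InTriangle (pos c) (pos (q j)) (pos a) (pos b) →
      ¬ InTriangle (pos c) (pos (q k)) (pos a) (pos b) → False := by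
    intro i j k hij hik hjk hi hj hk
    have h1 := sides i j hij hi hj
    have h2 := sides i k hik hi hk
    have h3 := sides j k hjk hj hk
    rcases (hne i).lt_or_gt with h | h <;> rcases (hne j).lt_or_gt with h' | h' <;>
      rcases (hne k).lt_or_gt with h'' | h'' <;> nlinarith
  by_cases h0 : InTriangle (pos c) (pos (q 0)) (pos a) (pos b)
  · exact three 1 2 3 (by decide) (by decide) (by decide) (fun h => once 0 1 (by decide) h0 h)
      (fun h => once 0 2 (by decide) h0 h) (fun h => once 0 3 (by decide) h0 h)
  by_cases h1 : InTriangle (pos c) (pos (q 1)) (pos a) (pos b)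
  · exact three 0 2 3 (by decide) (by decide) (by decide) h0
      (fun h => once 1 2 (by decide) h1 h) (fun h => once 1 3 (by decide) h1 h)
  by_cases h2 : InTriangle (pos c) (pos (q 2)) (pos a) (pos b)
  · exact three 0 1 3 (by decide) (by decide) (by decide) h0 h1
      (fun h => once 2 3 (by decide) h2 h)
  exact three 0 1 2 (by decide) (by decide) (by decide) h0 h1 h2

/-- Let `q x y r` be a `K₄` and let `p s` be an edge such that `q x y p s` is a wheel with hub `q`.
Then the triangle `q x y` separates `r` from `p s`. -/
theorem inTriangle_iff_not_inTriangle (D : IsStraightDrawing H pos) {q x y r p s : U}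
    (hqx : H.Adj q x) (hqy : H.Adj q y) (hxy : H.Adj x y) (hrq : H.Adj r q) (hrx : H.Adj r x)
    (hry : H.Adj r y) (hpq : H.Adj p q) (hpy : H.Adj p y) (hps : H.Adj p s) (hsx : H.Adj s x)
    (hpx : p ≠ x) (hpr : p ≠ r) (hsq : s ≠ q) (hsy : s ≠ y) (hsr : s ≠ r) :
    InTriangle (pos p) (pos q) (pos x) (pos y) ↔ ¬ InTriangle (pos r) (pos q) (pos x) (pos y) := by
  -- Each triangle at `r` contains `p` exactly when it contains the missing corner among `q`, `x`,
  -- `y`: a path from `p` to that corner avoids it. For `x` the path passes through `s`, since `p`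
  -- and `x` need not be adjacent.
  have sq : InTriangle (pos p) (pos r) (pos x) (pos y) ↔
      InTriangle (pos q) (pos r) (pos x) (pos y) :=
    D.inTriangle_iff hrx hxy hry hpq hpr hpx hpy.ne hrq.ne' hqx.ne hqy.ne
  have sx : InTriangle (pos p) (pos q) (pos r) (pos y) ↔
      InTriangle (pos x) (pos q) (pos r) (pos y) :=
    (D.inTriangle_iff hrq.symm hry hqy hps hpq.ne hpr hpy.ne hsq hsr hsy).trans
      (D.inTriangle_iff hrq.symm hry hqy hsx hsq hsr hsy hqx.ne' hrx.ne' hxy.ne)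
  have sy : InTriangle (pos p) (pos q) (pos x) (pos r) ↔
      InTriangle (pos y) (pos q) (pos x) (pos r) :=
    D.inTriangle_iff hqx hrx.symm hrq.symm hpy hpq.ne hpx hpr hqy.ne' hxy.ne' hry.ne'
  have m : ∀ a b c : U, InTriangle (pos b) (pos a) (pos b) (pos c) := fun a b c =>
    (inTriangle_left _ _ _).swap
  have r' : ∀ a b c : U, InTriangle (pos c) (pos a) (pos b) (pos c) := fun a b c =>
    (inTriangle_left _ _ _).rotate
  constructor
  · intro hp hr
    -- The part cut off by `r` that contains `p` would also contain the missing corner, which is an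
    -- extreme point of `q x y`.
    rcases hr.cover hp with h | h | h
    · exact D.not_inTriangle hqx hxy hqy hr (m _ _ _) (r' _ _ _) hrq.ne hqx.ne' hqy.ne' (sq.1 h)
    · exact D.not_inTriangle hxy hqy.symm hqx.symm (r' _ _ _) hr.rotate (m _ _ _) hqx.ne hrx.ne
        hxy.ne' (sx.1 h)
    · exact D.not_inTriangle hqy.symm hqx hxy.symm (m _ _ _) (r' _ _ _) hr.rotate.rotate hqy.ne
        hxy.ne hry.ne (sy.1 h)
  · intro hr
    -- If `r` is outside, a corner of `q x y` lies in the triangle formed by `r` and the other two,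
    -- and so does `p`. Of the three parts cut by that corner, extremality leaves only `q x y` for
    -- `p`.
    rcases inTriangle_of_disjoint_segments (D.signedArea_ne_zero hqx hxy hqy)
      (D.signedArea_ne_zero hrx hxy hry) (D.signedArea_ne_zero hrq.symm hry hqy)
      (D.signedArea_ne_zero hqx hrx.symm hrq.symm)
      (D.disjoint _ _ _ _ hqx hry.symm hqy.ne hrq.ne' hxy.ne hrx.ne')
      (D.disjoint _ _ _ _ hqy hrx.symm hqx.ne hrq.ne' hxy.ne' hry.ne')
      (D.disjoint _ _ _ _ hrq.symm hxy hqx.ne hqy.ne hrx.ne hry.ne) with h | h | h | h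
    · exact absurd h hr
    · rcases h.cover (sq.2 h) with h' | h' | h'
      · exact h'
      · exact absurd (sx.1 h'.swap) (D.not_inTriangle hxy hry.symm hrx.symm h.rotate (r' _ _ _)
          (m _ _ _) hqx.ne hrx.ne hxy.ne')
      · exact absurd (sy.1 h'.rotate.swap) (D.not_inTriangle hry.symm hrx hxy.symm
          h.rotate.rotate (r' _ _ _) (m _ _ _) hqy.ne hxy.ne hry.ne)
    · rcases h.cover (sx.2 h) with h' | h' | h'
      · exact absurd (sq.1 h'.swap) (D.not_inTriangle hrq.symm hry hqy (m _ _ _) h (r' _ _ _)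
          hrq.ne hqx.ne' hqy.ne')
      · exact h'
      · exact absurd (sy.1 h'.rotate.rotate.swap) (D.not_inTriangle hqy.symm hrq.symm hry.symm
          (m _ _ _) h.rotate.rotate (r' _ _ _) hqy.ne hxy.ne hry.ne)
    · rcases h.cover (sy.2 h) with h' | h' | h'
      · exact absurd (sq.1 h'.rotate.swap) (D.not_inTriangle hqx hrx.symm hrq.symm (r' _ _ _)
          (m _ _ _) h hrq.ne hqx.ne' hqy.ne')
      · exact absurd (sx.1 h'.rotate.rotate.swap) (D.not_inTriangle hrx.symm hrq hqx.symm
          (r' _ _ _) (m _ _ _) h.rotate hqx.ne hrx.ne hxy.ne')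
      · exact h'

/-- No crossing-free straight-line drawing contains three disjoint four-cycles and two vertices
joined to all vertices of the cycles. -/
theorem false_of_two_apices (D : IsStraightDrawing H pos) {x : Fin 3 → Fin 4 → U}
    (hx : IsCycleTriple H x) {q q' : U} (hqq' : q ≠ q') (hq : ∀ c k, H.Adj q (x c k))
    (hq' : ∀ c k, H.Adj q' (x c k)) : False := by
  have status : ∀ {q q' : U}, q ≠ q' → (∀ c k, H.Adj q (x c k)) → (∀ c k, H.Adj q' (x c k)) →
      ∀ c k d m, (c, k) ≠ (d, m) → (c, k + 1) ≠ (d, m) →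
      (InTriangle (pos (x d m)) (pos q) (pos (x c k)) (pos (x c (k + 1))) ↔
      InTriangle (pos q') (pos q) (pos (x c k)) (pos (x c (k + 1)))) := by
    intro q q' hqq' hq hq' c k d m h1 h2
    refine D.inTriangle_iff (hq c k) (hx.adj c k) (hq c (k + 1)) (hq' d m).symm (hq d m).ne'
      (fun h => h1 ?_) (fun h => h2 ?_) hqq'.symm (hq' c k).ne (hq' c (k + 1)).ne
    · obtain ⟨rfl, rfl⟩ := hx.inj _ _ _ _ h; rfl
    · obtain ⟨rfl, rfl⟩ := hx.inj _ _ _ _ h; rfl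
  have unique : ∀ {q q' : U}, q ≠ q' → (∀ c k, H.Adj q (x c k)) → (∀ c k, H.Adj q' (x c k)) →
      ∀ c k d m, c ≠ d → InTriangle (pos q') (pos q) (pos (x c k)) (pos (x c (k + 1))) →
      InTriangle (pos q') (pos q) (pos (x d m)) (pos (x d (m + 1))) → False := by
    intro q q' hqq' hq hq' c k d m hcd h1 h2
    have e1 := (status hqq' hq hq' c k d m (by simp [hcd]) (by simp [hcd])).2 h1
    have e2 := (status hqq' hq hq' c k d (m + 1) (by simp [hcd]) (by simp [hcd])).2 h1
    have e3 := (status hqq' hq hq' d m c k (by simp [hcd.symm]) (by simp [hcd.symm])).2 h2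
    exact D.not_inTriangle (hx.adj c k) (hq c (k + 1)).symm (hq c k).symm
      (inTriangle_left _ _ _).rotate e1.rotate e2.rotate (hq c k).ne
      (fun h => hcd (hx.inj _ _ _ _ h).1.symm) (fun h => hcd (hx.inj _ _ _ _ h).1.symm) e3
  -- Each of the two kinds of containment occurs for at most one cycle, so a third cycle is free of
  -- both.
  obtain ⟨c, hc⟩ : ∃ c, ∀ k, ¬ InTriangle (pos q') (pos q) (pos (x c k)) (pos (x c (k + 1))) ∧
      ¬ InTriangle (pos q) (pos q') (pos (x c k)) (pos (x c (k + 1))) := by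
    by_contra hcon
    push Not at hcon
    have hcon' : ∀ c, ∃ k, InTriangle (pos q') (pos q) (pos (x c k)) (pos (x c (k + 1))) ∨
        InTriangle (pos q) (pos q') (pos (x c k)) (pos (x c (k + 1))) := by
      intro c
      obtain ⟨k, hk⟩ := hcon c
      exact ⟨k, or_iff_not_imp_left.2 hk⟩
    have u := fun c k d m => unique hqq' hq hq' c k d m
    have u' := fun c k d m => unique hqq'.symm hq' hq c k d m
    obtain ⟨k₀, h0 | h0⟩ := hcon' 0 <;> obtain ⟨k₁, h1 | h1⟩ := hcon' 1 <;>
      obtain ⟨k₂, h2 | h2⟩ := hcon' 2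
    · exact u _ _ _ _ (by decide) h0 h1
    · exact u _ _ _ _ (by decide) h0 h1
    · exact u _ _ _ _ (by decide) h0 h2
    · exact u' _ _ _ _ (by decide) h1 h2
    · exact u _ _ _ _ (by decide) h1 h2
    · exact u' _ _ _ _ (by decide) h0 h2
    · exact u' _ _ _ _ (by decide) h0 h1
    · exact u' _ _ _ _ (by decide) h0 h1
  have ne1 : ∀ k : Fin 4, k ≠ k + 1 := by decide
  have ne2 : ∀ k : Fin 4, k ≠ k + 2 := by decide
  have ne3 : ∀ k : Fin 4, k + 1 ≠ k + 2 := by decide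
  have add2 : ∀ k : Fin 4, k + 1 + 1 = k + 2 := by decide
  have xne : ∀ {k m : Fin 4}, k ≠ m → x c k ≠ x c m := fun h e => h (hx.inj _ _ _ _ e).2
  -- On this cycle every side separates `q` from `q'`, and the triangles at `q` all turn the same
  -- way; otherwise two triangles would be nested.
  have opposite : ∀ k, signedArea (pos q) (pos (x c k)) (pos (x c (k + 1))) *
      signedArea (pos q') (pos (x c k)) (pos (x c (k + 1))) < 0 := by
    intro k
    have e : ∀ a b c, signedArea a b c = signedArea b c a := by
      intro a b c; simp only [signedArea]; ring
    rw [e (pos q), e (pos q')]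
    refine lt_of_le_of_ne ?_ (mul_ne_zero
      (D.signedArea_ne_zero (hx.adj c k) (hq c (k + 1)).symm (hq c k).symm)
      (D.signedArea_ne_zero (hx.adj c k) (hq' c (k + 1)).symm (hq' c k).symm))
    by_contra hcon
    rcases inTriangle_or_inTriangle (not_le.1 hcon)
      (D.disjoint _ _ _ _ (hq c k) (hq' c (k + 1)) hqq' (hq c (k + 1)).ne (hq' c k).ne'
        (xne (ne1 k)))
      (D.disjoint _ _ _ _ (hq c (k + 1)) (hq' c k) hqq' (hq c k).ne (hq' c (k + 1)).ne'
        (xne (ne1 k).symm)) with h | h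
    · exact (hc k).2 h
    · exact (hc k).1 h
  have consecutive : ∀ k, 0 < signedArea (pos q) (pos (x c k)) (pos (x c (k + 1))) *
      signedArea (pos q) (pos (x c (k + 1))) (pos (x c (k + 2))) := by
    intro k
    have hadj : H.Adj (x c (k + 1)) (x c (k + 2)) := add2 k ▸ hx.adj c (k + 1)
    have h0 := D.signedArea_ne_zero (hq c k) (hx.adj c k) (hq c (k + 1))
    have h1 := D.signedArea_ne_zero (hq c (k + 1)) hadj (hq c (k + 2))
    refine lt_of_le_of_ne ?_ (mul_ne_zero h0 h1).symm
    by_contra hcon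
    have hside : 0 < signedArea (pos q) (pos (x c (k + 1))) (pos (x c k)) *
        signedArea (pos q) (pos (x c (k + 1))) (pos (x c (k + 2))) := by
      have e : signedArea (pos q) (pos (x c (k + 1))) (pos (x c k)) =
        -signedArea (pos q) (pos (x c k)) (pos (x c (k + 1))) := by simp only [signedArea]; ring
      rw [e]; linarith
    rcases inTriangle_or_inTriangle hside
      (D.disjoint _ _ _ _ (hq c k).symm hadj.symm (xne (ne2 k)) (xne (ne1 k)) (hq c _).ne
        (hq c _).ne)
      (D.disjoint _ _ _ _ (hx.adj c k) (hq c (k + 2)).symm (xne (ne2 k)) (hq c _).ne'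
        (xne (ne3 k)) (hq c _).ne') with h | h
    · have h' := (status hqq' hq hq' c (k + 1) c k (by simp [(ne1 k).symm])
        (by rw [add2]; simp [(ne2 k).symm]))
      rw [add2] at h'
      have h2 := (hc (k + 1)).1
      rw [add2] at h2
      exact h2 (h'.1 h.rotate)
    · exact (hc k).1 ((status hqq' hq hq' c k c (k + 2) (by simp [ne2 k]) (by simp [ne3 k])).1
        h.swap)
  -- By the shoelace formula the sum of the areas does not depend on the apex, yet all terms for `q`
  -- have one sign and all for `q'` the other.
  have total : ∀ q : U, ∀ f : Fin 4 → ℝ,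
      (∀ k, f k = signedArea (pos q) (pos (x c k)) (pos (x c (k + 1)))) →
      f 0 + f 1 + f 2 + f 3 =
      (pos (x c 0)) 0 * (pos (x c 1)) 1 - (pos (x c 0)) 1 * (pos (x c 1)) 0 +
      ((pos (x c 1)) 0 * (pos (x c 2)) 1 - (pos (x c 1)) 1 * (pos (x c 2)) 0) +
      ((pos (x c 2)) 0 * (pos (x c 3)) 1 - (pos (x c 2)) 1 * (pos (x c 3)) 0) +
      ((pos (x c 3)) 0 * (pos (x c 0)) 1 - (pos (x c 3)) 1 * (pos (x c 0)) 0) := by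
    intro q f hf
    simp only [hf, signedArea, (by decide : (0 : Fin 4) + 1 = 1), (by decide : (1 : Fin 4) + 1 = 2),
      (by decide : (2 : Fin 4) + 1 = 3), (by decide : (3 : Fin 4) + 1 = 0)]
    ring
  let f : Fin 4 → ℝ := fun k => signedArea (pos q) (pos (x c k)) (pos (x c (k + 1)))
  let g : Fin 4 → ℝ := fun k => signedArea (pos q') (pos (x c k)) (pos (x c (k + 1)))
  have hfg := (total q f fun _ => rfl).trans (total q' g fun _ => rfl).symm
  have hf : ∀ k, 0 < f k * f (k + 1) := by
    intro k; simp only [f, add2]; exact consecutive k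
  have hneg : ∀ k, f k * g k < 0 := opposite
  have f0 : 0 < f 0 * f 1 := hf 0
  have f1 : 0 < f 1 * f 2 := hf 1
  have f2 : 0 < f 2 * f 3 := hf 2
  have g0 := hneg 0
  have g1 := hneg 1
  have g2 := hneg 2
  have g3 := hneg 3
  rcases lt_or_ge 0 (f 0) with h | h
  · have h1 : 0 < f 1 := by by_contra hc; nlinarith
    have h2 : 0 < f 2 := by by_contra hc; nlinarith
    have h3 : 0 < f 3 := by by_contra hc; nlinarith
    have k0 : g 0 < 0 := by by_contra hc; nlinarith
    have k1 : g 1 < 0 := by by_contra hc; nlinarith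
    have k2 : g 2 < 0 := by by_contra hc; nlinarith
    have k3 : g 3 < 0 := by by_contra hc; nlinarith
    linarith
  · have h0 : f 0 < 0 := lt_of_le_of_ne h (by intro h0; simp [h0] at f0)
    have h1 : f 1 < 0 := by by_contra hc; nlinarith
    have h2 : f 2 < 0 := by by_contra hc; nlinarith
    have h3 : f 3 < 0 := by by_contra hc; nlinarith
    have k0 : 0 < g 0 := by by_contra hc; nlinarith
    have k1 : 0 < g 1 := by by_contra hc; nlinarith
    have k2 : 0 < g 2 := by by_contra hc; nlinarith
    have k3 : 0 < g 3 := by by_contra hc; nlinarith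
    linarith

/-- If `q` is joined to three four-cycles and `r` to `q` and to the `i`-th edge of each cycle, then
for two of the cycles the triangle spanned by `q` and the `i`-th edge contains the cycle. -/
theorem cycle_subset_triangle (D : IsStraightDrawing H pos) {x : Fin 3 → Fin 4 → U}
    (hx : IsCycleTriple H x) {q r : U} {i : Fin 4} (hq : ∀ c k, H.Adj q (x c k))
    (hrq : H.Adj r q) (hr : ∀ c, H.Adj r (x c i)) (hr' : ∀ c, H.Adj r (x c (i + 1)))
    (hrx : ∀ c k, r ≠ x c k) {c d : Fin 3} (hcd : c ≠ d) :
    (InTriangle (pos (x c (i + 2))) (pos q) (pos (x c i)) (pos (x c (i + 1))) ∧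
      InTriangle (pos (x c (i + 3))) (pos q) (pos (x c i)) (pos (x c (i + 1)))) ∨
    (InTriangle (pos (x d (i + 2))) (pos q) (pos (x d i)) (pos (x d (i + 1))) ∧
      InTriangle (pos (x d (i + 3))) (pos q) (pos (x d i)) (pos (x d (i + 1)))) := by
  have add2 : ∀ k : Fin 4, k + 1 + 1 = k + 2 := by decide
  have add3 : ∀ k : Fin 4, k + 2 + 1 = k + 3 := by decide
  have add4 : ∀ k : Fin 4, k + 3 + 1 = k := by decide
  have n02 : ∀ k : Fin 4, k + 2 ≠ k := by decide
  have n03 : ∀ k : Fin 4, k + 3 ≠ k := by decide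
  have n12 : ∀ k : Fin 4, k + 2 ≠ k + 1 := by decide
  have n13 : ∀ k : Fin 4, k + 3 ≠ k + 1 := by decide
  have xne : ∀ {c k m}, k ≠ m → x c k ≠ x c m := fun h e => h (hx.inj _ _ _ _ e).2
  have xne' : ∀ {c d k m}, c ≠ d → x c k ≠ x d m := fun h e => h (hx.inj _ _ _ _ e).1
  have hps : ∀ c, H.Adj (x c (i + 2)) (x c (i + 3)) := fun c => add3 i ▸ hx.adj c (i + 2)
  have hpy : ∀ c, H.Adj (x c (i + 1)) (x c (i + 2)) := fun c => add2 i ▸ hx.adj c (i + 1)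
  have hsx : ∀ c, H.Adj (x c (i + 3)) (x c i) := fun c => by
    have := hx.adj c (i + 3); rwa [add4] at this
  -- The two remaining cycle vertices are adjacent, hence on one side of the triangle; if they are
  -- outside, `r` is inside.
  have step : ∀ c, ¬ (InTriangle (pos (x c (i + 2))) (pos q) (pos (x c i)) (pos (x c (i + 1))) ∧
      InTriangle (pos (x c (i + 3))) (pos q) (pos (x c i)) (pos (x c (i + 1)))) →
      InTriangle (pos r) (pos q) (pos (x c i)) (pos (x c (i + 1))) := by
    intro c hc
    have h1 := D.inTriangle_iff (hq c i) (hx.adj c i) (hq c (i + 1)) (hps c) (hq c _).ne'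
      (xne (n02 i)) (xne (n12 i)) (hq c _).ne' (xne (n03 i)) (xne (n13 i))
    have h2 := D.inTriangle_iff_not_inTriangle (hq c i) (hq c (i + 1)) (hx.adj c i) hrq (hr c)
      (hr' c) (hq c (i + 2)).symm (hpy c).symm (hps c) (hsx c) (xne (n02 i)) (hrx c _).symm
      (hq c _).ne' (xne (n13 i)) (hrx c _).symm
    tauto
  -- Once inside, `r` draws its neighbours on the other cycle in with it. If this happened for both
  -- `c` and `d`, each triangle would contain corners of the other.
  have inside : ∀ c d, c ≠ d → InTriangle (pos r) (pos q) (pos (x c i)) (pos (x c (i + 1))) →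
      InTriangle (pos (x d i)) (pos q) (pos (x c i)) (pos (x c (i + 1))) ∧
      InTriangle (pos (x d (i + 1))) (pos q) (pos (x c i)) (pos (x c (i + 1))) := by
    intro c d hcd h
    exact ⟨(D.inTriangle_iff (hq c i) (hx.adj c i) (hq c (i + 1)) (hr d) hrq.ne (hrx _ _) (hrx _ _)
        (hq d _).ne' (xne' hcd.symm) (xne' hcd.symm)).1 h,
      (D.inTriangle_iff (hq c i) (hx.adj c i) (hq c (i + 1)) (hr' d) hrq.ne (hrx _ _) (hrx _ _)
        (hq d _).ne' (xne' hcd.symm) (xne' hcd.symm)).1 h⟩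
  by_contra hcon
  rw [not_or] at hcon
  obtain ⟨h1, h2⟩ := inside c d hcd (step c hcon.1)
  obtain ⟨h3, -⟩ := inside d c hcd.symm (step d hcon.2)
  exact D.not_inTriangle (hx.adj c i) (hq c (i + 1)).symm (hq c i).symm
    (inTriangle_left _ _ _).rotate h1.rotate h2.rotate (hq c i).ne
    (xne' hcd.symm) (xne' hcd.symm) h3

end IsStraightDrawing

/-! ### From frames of a storyplan to straight-line drawings. -/

/-- Three consecutive cycle vertices do not form a triangle of the graph, so the drawing alone does
not make them non-collinear; lying in a triangle over a side, but off that side, does. -/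
theorem InTriangle.signedArea_ne_zero {p a b c : Plane} (hp : InTriangle p a b c)
    (h : signedArea b c a ≠ 0) (hbc : p ∉ segment ℝ b c) : signedArea b c p ≠ 0 := by
  obtain ⟨α, β, γ, hα, hβ, hγ, hs, e0, e1⟩ := hp
  have e : signedArea b c p = α * signedArea b c a := by
    obtain rfl : α = 1 - β - γ := by linarith
    simp only [signedArea, e0, e1]; ring
  rw [e]
  refine mul_ne_zero ?_ h
  rintro rfl
  exact hbc (mem_segment_coord.2 ⟨β, γ, hβ, hγ, by linarith, by linarith, by linarith⟩)

namespace WitnessVertex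

theorem adj_apex_cyc (i : Fin 4) (j : Fin 2) (c : Fin 3) (k : Fin 4) :
    witnessGraph.Adj (.apex i j) (.cyc c k) := by
  simp [witnessGraph, SimpleGraph.fromRel_adj, WitnessRel]

theorem adj_cyc_cyc (c : Fin 3) (k : Fin 4) : witnessGraph.Adj (.cyc c k) (.cyc c (k + 1)) := by
  simp [witnessGraph, SimpleGraph.fromRel_adj, WitnessRel]

theorem adj_edg_apex (i : Fin 4) (j : Fin 2) : witnessGraph.Adj (.edg i j) (.apex i j) := by
  simp [witnessGraph, SimpleGraph.fromRel_adj, WitnessRel]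

theorem adj_edg_cyc (i : Fin 4) (j : Fin 2) (c : Fin 3) :
    witnessGraph.Adj (.edg i j) (.cyc c i) := by
  simp [witnessGraph, SimpleGraph.fromRel_adj, WitnessRel]

theorem adj_edg_cyc_succ (i : Fin 4) (j : Fin 2) (c : Fin 3) :
    witnessGraph.Adj (.edg i j) (.cyc c (i + 1)) := by
  simp [witnessGraph, SimpleGraph.fromRel_adj, WitnessRel]

end WitnessVertex

theorem IsPlanarDrawing.isStraightDrawing {V : Type*} {G : SimpleGraph V} {W : Set V}
    {pos : V → Plane} {curve : Sym2 V → Set Plane} (hD : IsPlanarDrawing G W pos curve)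
    (hs : ∀ u ∈ W, ∀ v ∈ W, G.Adj u v → curve s(u, v) = segment ℝ (pos u) (pos v)) :
    IsStraightDrawing (G.induce W) (fun v => pos v) where
  injective := fun u v h => Subtype.ext (hD.pos_injOn u.2 v.2 h)
  eq_or_eq := by
    rintro ⟨u, hu⟩ ⟨v, hv⟩ ⟨w, hw⟩ huv h
    have huv : G.Adj u v := huv
    rw [← hs u hu v hv huv] at h
    simpa using hD.mem_of_pos_mem s(u, v) ⟨huv, by simp [hu, hv]⟩ w hw h
  disjoint := by
    rintro ⟨u, hu⟩ ⟨v, hv⟩ ⟨u', hu'⟩ ⟨v', hv'⟩ h h' h1 h2 h3 h4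
    have h : G.Adj u v := h
    have h' : G.Adj u' v' := h'
    simp only [ne_eq, Subtype.mk.injEq] at h1 h2 h3 h4
    rw [← hs u hu v hv h, ← hs u' hu' v' hv' h', Set.disjoint_left]
    intro x hx hx'
    obtain ⟨w, hw, hw', -⟩ := hD.inter_subset s(u, v) ⟨h, by simp [hu, hv]⟩ s(u', v')
      ⟨h', by simp [hu', hv']⟩ (by simp [h1, h2]) ⟨hx, hx'⟩
    simp only [Sym2.mem_iff] at hw hw'
    rcases hw with rfl | rfl <;> rcases hw' with rfl | rfl <;> contradiction

namespace Storyplan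

variable {V : Type*} {G : SimpleGraph V} {ℓ : ℕ}

theorem mem_Icc_of_mem_visible (S : Storyplan G ℓ) {v : V} {t : ℕ} (h : v ∈ S.visible t) :
    t ∈ Set.Icc 1 ℓ :=
  ⟨(S.one_le_first v).trans h.1, h.2.trans (S.last_le v)⟩

theorem IsPlanarGeometric.isStraightDrawing {S : Storyplan G ℓ} (hS : S.IsPlanarGeometric) {v : V}
    {t : ℕ} (h : v ∈ S.visible t) :
    IsStraightDrawing (G.induce (S.visible t)) (fun v => S.pos v) :=
  (hS t (S.mem_Icc_of_mem_visible h)).1.isStraightDrawing (hS t (S.mem_Icc_of_mem_visible h)).2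

theorem first_le_last_of_adj (S : Storyplan G ℓ) {u v : V} (h : G.Adj u v) :
    S.first u ≤ S.last v ∧ S.first v ≤ S.last u := by
  obtain ⟨t, ⟨h1, h2⟩, h3, h4⟩ := S.coOccur u v h
  exact ⟨h1.trans h4, h3.trans h2⟩

/-- Pairwise intersecting visible intervals have a common time step. -/
theorem exists_visible [Fintype V] (S : Storyplan G ℓ) (P : V → Prop)
    (h : ∀ u v, P u → P v → S.first u ≤ S.last v) : ∃ t, ∀ v, P v → v ∈ S.visible t := by
  classical
  -- One-dimensional Helly: the latest start serves as common time step.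
  refine ⟨(Finset.univ.filter P).sup S.first, fun v hv => ⟨?_, ?_⟩⟩
  · exact Finset.le_sup (f := S.first) (by simpa using hv)
  · exact Finset.sup_le fun u hu => h u v (by simpa using hu) hv

end Storyplan

/-! ### Visible intervals in a geometric storyplan of the witness graph. -/

open WitnessVertex

namespace WitnessVertex

variable {ℓ : ℕ} {S : Storyplan witnessGraph ℓ}

theorem isCycleTriple {t : ℕ} (h : ∀ c k, cyc c k ∈ S.visible t) :
    IsCycleTriple (witnessGraph.induce (S.visible t)) (fun c k => ⟨cyc c k, h c k⟩) where
  adj := fun c k => adj_cyc_cyc c k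
  inj := fun c k c' k' h => by simpa using h

theorem exists_last_lt_first (hS : S.IsPlanarGeometric) :
    ∃ i j i' j', S.last (apex i j) < S.first (apex i' j') := by
  by_contra hcon
  push Not at hcon
  -- Interval graphs have no induced four-cycle, so some pair of opposite vertices overlaps in time.
  obtain ⟨k, hk, hk'⟩ : ∃ k : Fin 4, S.first (cyc 0 k) ≤ S.last (cyc 0 (k + 2)) ∧
      S.first (cyc 0 (k + 2)) ≤ S.last (cyc 0 k) := by
    by_contra hc
    push Not at hc
    have h02 := hc 0
    have h13 := hc 1
    have h01 := S.first_le_last_of_adj (adj_cyc_cyc 0 0)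
    have h12 := S.first_le_last_of_adj (adj_cyc_cyc 0 1)
    have h23 := S.first_le_last_of_adj (adj_cyc_cyc 0 2)
    have h30 := S.first_le_last_of_adj (adj_cyc_cyc 0 3)
    simp only [zero_add, (by decide : (1 : Fin 4) + 1 = 2), (by decide : (1 : Fin 4) + 2 = 3),
      (by decide : (2 : Fin 4) + 1 = 3), (by decide : (3 : Fin 4) + 1 = 0)] at *
    have g0 := S.first_le_last (cyc 0 0)
    have g1 := S.first_le_last (cyc 0 1)
    have g2 := S.first_le_last (cyc 0 2)
    have g3 := S.first_le_last (cyc 0 3)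
    omega
  have h1 := S.first_le_last_of_adj (adj_cyc_cyc 0 k)
  have h2 := S.first_le_last_of_adj (adj_cyc_cyc 0 (k + 1))
  rw [(by decide : ∀ k : Fin 4, k + 1 + 1 = k + 2) k] at h2
  obtain ⟨t, ht⟩ := S.exists_visible (fun v => (∃ i j, v = apex i j) ∨ v = cyc 0 k ∨
      v = cyc 0 (k + 1) ∨ v = cyc 0 (k + 2)) (by
    rintro u v (⟨i, j, rfl⟩ | rfl | rfl | rfl) (⟨i', j', rfl⟩ | rfl | rfl | rfl)
    any_goals exact hcon _ _ _ _
    any_goals exact S.first_le_last _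
    any_goals exact (S.first_le_last_of_adj (adj_apex_cyc _ _ _ _)).1
    any_goals exact (S.first_le_last_of_adj (adj_apex_cyc _ _ _ _)).2
    all_goals first | exact h1.1 | exact h1.2 | exact h2.1 | exact h2.2 | assumption)
  have hq : ∀ i, apex i 0 ∈ S.visible t := fun i => ht _ (.inl ⟨i, 0, rfl⟩)
  have ha : cyc 0 k ∈ S.visible t := ht _ (.inr (.inl rfl))
  have hb : cyc 0 (k + 1) ∈ S.visible t := ht _ (.inr (.inr (.inl rfl)))
  have hc : cyc 0 (k + 2) ∈ S.visible t := ht _ (.inr (.inr (.inr rfl)))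
  refine (hS.isStraightDrawing ha).false_of_four_common_neighbours (a := ⟨_, ha⟩) (b := ⟨_, hb⟩)
    (c := ⟨_, hc⟩) (q := fun i => ⟨_, hq i⟩) (fun i i' h => by simpa using h)
    (adj_cyc_cyc 0 k) ?_ ?_ (fun i => adj_apex_cyc _ _ _ _) (fun i => adj_apex_cyc _ _ _ _)
    (fun i => adj_apex_cyc _ _ _ _)
  · simp
  · simp only [ne_eq, Subtype.mk.injEq, cyc.injEq, true_and]
    exact (by decide : ∀ k : Fin 4, k + 2 ≠ k + 1) k

/-- Every cycle vertex meets two apex vertices with disjoint intervals and therefore covers the gap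
between them. -/
theorem first_cyc_le_last_cyc (hS : S.IsPlanarGeometric) (c c' : Fin 3) (k k' : Fin 4) :
    S.first (cyc c k) ≤ S.last (cyc c' k') := by
  obtain ⟨i, j, i', j', h⟩ := exists_last_lt_first hS
  have h1 := (S.first_le_last_of_adj (adj_apex_cyc i j c k)).2
  have h2 := (S.first_le_last_of_adj (adj_apex_cyc i' j' c' k')).1
  omega

theorem last_apex_lt_first_apex (hS : S.IsPlanarGeometric) {i i' : Fin 4} {j j' : Fin 2}
    (hne : (i, j) ≠ (i', j')) : S.last (apex i j) < S.first (apex i' j') ∨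
      S.last (apex i' j') < S.first (apex i j) := by
  by_contra hcon
  push Not at hcon
  obtain ⟨t, ht⟩ := S.exists_visible (fun v => (∃ c k, v = cyc c k) ∨ v = apex i j ∨
      v = apex i' j') (by
    rintro u v (⟨c, k, rfl⟩ | rfl | rfl) (⟨c', k', rfl⟩ | rfl | rfl)
    any_goals exact first_cyc_le_last_cyc hS _ _ _ _
    any_goals exact S.first_le_last _
    any_goals exact (S.first_le_last_of_adj (adj_apex_cyc _ _ _ _)).1
    any_goals exact (S.first_le_last_of_adj (adj_apex_cyc _ _ _ _)).2
    · exact hcon.2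
    · exact hcon.1)
  have hx : ∀ c k, cyc c k ∈ S.visible t := fun c k => ht _ (.inl ⟨c, k, rfl⟩)
  have hq : apex i j ∈ S.visible t := ht _ (.inr (.inl rfl))
  have hq' : apex i' j' ∈ S.visible t := ht _ (.inr (.inr rfl))
  exact (hS.isStraightDrawing hq).false_of_two_apices (isCycleTriple hx) (q := ⟨_, hq⟩)
    (q' := ⟨_, hq'⟩) (by simpa using hne) (fun c k => adj_apex_cyc _ _ _ _)
    (fun c k => adj_apex_cyc _ _ _ _)

/-- All but two of the apex vertices are visible only together with all cycle vertices. -/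
theorem exists_apex_pair (hS : S.IsPlanarGeometric) : ∃ s s' : Fin 4 × Fin 2, ∀ i j,
    (i, j) ≠ s → (i, j) ≠ s' → ∀ c k, S.first (cyc c k) ≤ S.first (apex i j) ∧
      S.last (apex i j) ≤ S.last (cyc c k) := by
  -- The exceptions are the apex vertices with earliest and latest start. Every cycle vertex meets
  -- both, hence stays visible throughout any apex interval in between.
  obtain ⟨s, hs⟩ := Finite.exists_min (fun s : Fin 4 × Fin 2 => S.first (apex s.1 s.2))
  obtain ⟨s', hs'⟩ := Finite.exists_max (fun s : Fin 4 × Fin 2 => S.first (apex s.1 s.2))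
  refine ⟨s, s', fun i j h h' c k => ?_⟩
  have h1 := last_apex_lt_first_apex hS (i := i) (j := j) (i' := s.1) (j' := s.2) h
  have h2 := last_apex_lt_first_apex hS (i := i) (j := j) (i' := s'.1) (j' := s'.2) h'
  have h3 := hs (i, j)
  have h4 := hs' (i, j)
  have h5 := S.first_le_last (apex i j)
  have h6 := S.first_le_last (apex s.1 s.2)
  have h6' := S.first_le_last (apex s'.1 s'.2)
  have h7 := (S.first_le_last_of_adj (adj_apex_cyc s.1 s.2 c k)).2
  have h8 := (S.first_le_last_of_adj (adj_apex_cyc s'.1 s'.2 c k)).1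
  simp only at h3 h4
  omega

theorem cycle_subset_triangle (hS : S.IsPlanarGeometric) {i : Fin 4} {j : Fin 2}
    (h : ∀ c k, S.first (cyc c k) ≤ S.first (apex i j) ∧
      S.last (apex i j) ≤ S.last (cyc c k)) {c d : Fin 3} (hcd : c ≠ d) :
    (InTriangle (S.pos (cyc c (i + 2))) (S.pos (apex i j)) (S.pos (cyc c i))
        (S.pos (cyc c (i + 1))) ∧
      InTriangle (S.pos (cyc c (i + 3))) (S.pos (apex i j)) (S.pos (cyc c i))
        (S.pos (cyc c (i + 1)))) ∨
    (InTriangle (S.pos (cyc d (i + 2))) (S.pos (apex i j)) (S.pos (cyc d i))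
        (S.pos (cyc d (i + 1))) ∧
      InTriangle (S.pos (cyc d (i + 3))) (S.pos (apex i j)) (S.pos (cyc d i))
        (S.pos (cyc d (i + 1)))) := by
  obtain ⟨t, hr, hq⟩ := S.coOccur _ _ (adj_edg_apex i j)
  have hx : ∀ c k, cyc c k ∈ S.visible t := fun c k =>
    ⟨(h c k).1.trans hq.1, hq.2.trans (h c k).2⟩
  exact (hS.isStraightDrawing (v := apex i j) hq).cycle_subset_triangle (isCycleTriple hx)
    (q := ⟨apex i j, hq⟩) (r := ⟨edg i j, hr⟩) (fun c k => adj_apex_cyc _ _ _ _)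
    (adj_edg_apex i j) (fun c => adj_edg_cyc i j c) (fun c => adj_edg_cyc_succ i j c)
    (fun c k h => by simpa using congrArg Subtype.val h) hcd

theorem signedArea_apex_ne_zero (hS : S.IsPlanarGeometric) {i : Fin 4} {j : Fin 2}
    (h : ∀ c k, S.first (cyc c k) ≤ S.first (apex i j) ∧
      S.last (apex i j) ≤ S.last (cyc c k)) (c : Fin 3) :
    signedArea (S.pos (cyc c i)) (S.pos (cyc c (i + 1))) (S.pos (apex i j)) ≠ 0 := by
  have hq : apex i j ∈ S.visible (S.first (apex i j)) := ⟨le_rfl, S.first_le_last _⟩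
  have hx : ∀ k, cyc c k ∈ S.visible (S.first (apex i j)) := fun k =>
    ⟨(h c k).1, (S.first_le_last _).trans (h c k).2⟩
  exact (hS.isStraightDrawing hq).signedArea_ne_zero (u := ⟨_, hx i⟩) (v := ⟨_, hx (i + 1)⟩)
    (w := ⟨_, hq⟩) (adj_cyc_cyc c i) (adj_apex_cyc _ _ _ _).symm (adj_apex_cyc _ _ _ _).symm

end WitnessVertex

/-! ### The contradiction for straight-line storyplans. -/

/-- Each property fails for at most one of the three cycles, so some cycle has both. -/
theorem exists_and_of_pairwise_or {P Q : Fin 3 → Prop} (hP : ∀ c d, c ≠ d → P c ∨ P d)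
    (hQ : ∀ c d, c ≠ d → Q c ∨ Q d) : ∃ c, P c ∧ Q c := by
  by_contra hcon
  rw [not_exists] at hcon
  have h0 := hcon 0
  have h1 := hcon 1
  have h2 := hcon 2
  have p01 := hP 0 1 (by decide)
  have p02 := hP 0 2 (by decide)
  have p12 := hP 1 2 (by decide)
  have q01 := hQ 0 1 (by decide)
  have q02 := hQ 0 2 (by decide)
  have q12 := hQ 1 2 (by decide)
  grind

/-- This is why there are two copies of every apex vertex: discarding any two still leaves an
opposite pair of indices. -/
theorem exists_opposite_ne : ∀ s s' : Fin 4 × Fin 2, ∃ (i : Fin 4) (j j' : Fin 2),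
    (i, j) ≠ s ∧ (i, j) ≠ s' ∧ (i + 2, j') ≠ s ∧ (i + 2, j') ≠ s' := by
  decide

theorem not_admitsPlanarGeometricStoryplan_witnessGraph :
    ¬ AdmitsPlanarGeometricStoryplan witnessGraph := by
  rintro ⟨ℓ, S, hS⟩
  obtain ⟨s, s', hs⟩ := exists_apex_pair hS
  obtain ⟨i, j, j', h1, h2, h3, h4⟩ : ∃ (i : Fin 4) (j j' : Fin 2), (i, j) ≠ s ∧ (i, j) ≠ s' ∧
      (i + 2, j') ≠ s ∧ (i + 2, j') ≠ s' :=
    exists_opposite_ne s s'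
  have hq := hs i j h1 h2
  have hq' := hs (i + 2) j' h3 h4
  have e1 := (by decide : ∀ i : Fin 4, i + 2 + 1 = i + 3) i
  have e2 := (by decide : ∀ i : Fin 4, i + 2 + 2 = i) i
  have e3 := (by decide : ∀ i : Fin 4, i + 2 + 3 = i + 1) i
  have e4 := (by decide : ∀ i : Fin 4, i + 3 + 1 = i) i
  have e5 := (by decide : ∀ i : Fin 4, i + 1 + 1 = i + 2) i
  have A := fun c d (h : c ≠ d) => cycle_subset_triangle hS hq h
  have B := fun c d (h : c ≠ d) => cycle_subset_triangle hS hq' h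
  simp only [e1, e2, e3] at B
  obtain ⟨c, ⟨a1, a2⟩, b1, b2⟩ := exists_and_of_pairwise_or A B
  -- The two apex vertices are never visible together, but a frame with all cycle vertices is enough
  -- to keep the other two sides of the quadrilateral disjoint.
  obtain ⟨t, ht⟩ := S.exists_visible (fun v => ∃ c k, v = cyc c k) (by
    rintro _ _ ⟨c, k, rfl⟩ ⟨c', k', rfl⟩
    exact first_cyc_le_last_cyc hS _ _ _ _)
  have hx : ∀ c k, cyc c k ∈ S.visible t := fun c k => ht _ ⟨c, k, rfl⟩
  have D := hS.isStraightDrawing (hx c 0)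
  have adj := (isCycleTriple hx).adj c
  have ne : ∀ {k m}, k ≠ m → (⟨cyc c k, hx c k⟩ : S.visible t) ≠ ⟨cyc c m, hx c m⟩ :=
    fun h e => h ((isCycleTriple hx).inj _ _ _ _ e).2
  have n01 := (by decide : ∀ i : Fin 4, i ≠ i + 1) i
  have n02 := (by decide : ∀ i : Fin 4, i ≠ i + 2) i
  have n03 := (by decide : ∀ i : Fin 4, i ≠ i + 3) i
  have n12 := (by decide : ∀ i : Fin 4, i + 1 ≠ i + 2) i
  have n13 := (by decide : ∀ i : Fin 4, i + 1 ≠ i + 3) i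
  have n23 := (by decide : ∀ i : Fin 4, i + 2 ≠ i + 3) i
  have off : ∀ {k m : Fin 4}, k ≠ m → k + 1 ≠ m →
      S.pos (cyc c m) ∉ segment ℝ (S.pos (cyc c k)) (S.pos (cyc c (k + 1))) := by
    intro k m h h' hm
    rcases D.eq_or_eq _ _ ⟨cyc c m, hx c m⟩ (adj k) hm with e | e
    · exact ne h e.symm
    · exact ne h' e.symm
  have z := signedArea_apex_ne_zero hS hq c
  have z' := signedArea_apex_ne_zero hS hq' c
  have o1 := off (k := i + 2) (m := i) n02.symm (e1 ▸ n03.symm)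
  have o2 := off (k := i + 2) (m := i + 1) n12.symm (e1 ▸ n13.symm)
  rw [e1] at o1 o2 z'
  have d1 := a1.signedArea_ne_zero z (off n02 n12)
  have d2 := a2.signedArea_ne_zero z (off n03 n13)
  have d3 := b1.signedArea_ne_zero z' o1
  have d4 := b2.signedArea_ne_zero z' o2
  have k1 := adj (i + 1)
  have k2 := adj (i + 3)
  simp only [e4, e5] at k1 k2
  exact not_disjoint_of_opposite_triangles d1 d2 d3 d4 a1 a2 b1 b2
    (D.disjoint _ _ _ _ k2.symm k1 (ne n01) (ne n02) (ne n13.symm) (ne n23.symm))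

/-! ### Polygonal paths with integer coordinates. -/

/-- The point of the plane with given integer coordinates. -/
noncomputable def latticePoint (p : ℤ × ℤ) : Plane := !₂[(p.1 : ℝ), (p.2 : ℝ)]

/-- Twice the signed area of a lattice triangle. -/
def latticeArea (p q r : ℤ × ℤ) : ℤ :=
  (q.1 - p.1) * (r.2 - p.2) - (q.2 - p.2) * (r.1 - p.1)

/-- The cross product of the directions of two lattice segments. -/
def latticeCross (s s' : (ℤ × ℤ) × (ℤ × ℤ)) : ℤ :=
  (s.2.1 - s.1.1) * (s'.2.2 - s'.1.2) - (s.2.2 - s.1.2) * (s'.2.1 - s'.1.1)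

/-- The segment spanned by a pair of lattice points. -/
def latticeSegment (s : (ℤ × ℤ) × (ℤ × ℤ)) : Set Plane :=
  segment ℝ (latticePoint s.1) (latticePoint s.2)

@[simp] theorem latticePoint_zero (p : ℤ × ℤ) : latticePoint p 0 = p.1 := by simp [latticePoint]

@[simp] theorem latticePoint_one (p : ℤ × ℤ) : latticePoint p 1 = p.2 := by simp [latticePoint]

theorem signedArea_latticePoint (p q r : ℤ × ℤ) :
    signedArea (latticePoint p) (latticePoint q) (latticePoint r) = latticeArea p q r := by
  simp [signedArea, latticeArea]

theorem latticePoint_injective : Function.Injective latticePoint := by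
  intro p q h
  have h0 := congrArg (fun x : Plane => x 0) h
  have h1 := congrArg (fun x : Plane => x 1) h
  simp only [latticePoint_zero, latticePoint_one, Int.cast_inj] at h0 h1
  exact Prod.ext h0 h1

theorem disjoint_segment_of_same_side {p q r s : Plane}
    (h : 0 < signedArea p q r * signedArea p q s) :
    Disjoint (segment ℝ p q) (segment ℝ r s) := by
  rw [Set.disjoint_left]
  intro x hx hx'
  obtain ⟨a, b, ha, hb, hab, e0, e1⟩ := mem_segment_coord.1 hx
  obtain ⟨c, d, hc, hd, hcd, f0, f1⟩ := mem_segment_coord.1 hx'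
  have h0 : signedArea p q x = 0 := by
    obtain rfl : a = 1 - b := by linarith
    simp only [signedArea, e0, e1]; ring
  have h1 : signedArea p q x = c * signedArea p q r + d * signedArea p q s := by
    obtain rfl : c = 1 - d := by linarith
    simp only [signedArea, f0, f1]; ring
  rw [h0] at h1
  generalize signedArea p q r = y at *
  generalize signedArea p q s = z at *
  rcases pos_and_pos_or_neg_and_neg_of_mul_pos h with ⟨hy, hz⟩ | ⟨hy, hz⟩
  · rcases hc.eq_or_lt with rfl | hc
    · obtain rfl : d = 1 := by linarith
      linarith
    · nlinarith [mul_pos hc hy, mul_nonneg hd hz.le]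
  · rcases hc.eq_or_lt with rfl | hc
    · obtain rfl : d = 1 := by linarith
      linarith
    · nlinarith [mul_neg_of_pos_of_neg hc hy, mul_nonpos_of_nonneg_of_nonpos hd hz.le]

/-- Non-parallel pieces meet at most once, so a shared end point accounts for every common point. -/
theorem eq_of_mem_latticeSegment {s s' : (ℤ × ℤ) × (ℤ × ℤ)} (h : latticeCross s s' ≠ 0)
    {x z : Plane} (hx : x ∈ latticeSegment s) (hx' : x ∈ latticeSegment s')
    (hz : z ∈ latticeSegment s) (hz' : z ∈ latticeSegment s') : x = z := by
  have h : ((latticeCross s s' : ℤ) : ℝ) ≠ 0 := by exact_mod_cast h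
  simp only [latticeSegment, mem_segment_coord, latticePoint_zero, latticePoint_one] at *
  obtain ⟨a, b, -, -, hab, x0, x1⟩ := hx
  obtain ⟨a', b', -, -, hab', x0', x1'⟩ := hx'
  obtain ⟨c, d, -, -, hcd, z0, z1⟩ := hz
  obtain ⟨c', d', -, -, hcd', z0', z1'⟩ := hz'
  obtain rfl : a = 1 - b := by linarith
  obtain rfl : a' = 1 - b' := by linarith
  obtain rfl : c = 1 - d := by linarith
  obtain rfl : c' = 1 - d' := by linarith
  have key : (b - d) * (latticeCross s s' : ℤ) = 0 := by
    simp only [latticeCross]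
    push_cast
    linear_combination (x0' - x0 - z0' + z0) * (s'.2.2 - s'.1.2 : ℝ) -
      (x1' - x1 - z1' + z1) * (s'.2.1 - s'.1.1 : ℝ)
  have hbd : b = d := by
    have := (mul_eq_zero.1 key).resolve_right h
    linarith
  subst hbd
  exact plane_ext (x0.trans z0.symm) (x1.trans z1.symm)

theorem IsSimpleCurve.symm {p q : Plane} {C : Set Plane} (h : IsSimpleCurve p q C) :
    IsSimpleCurve q p C := by
  obtain ⟨γ, hc, hi, h0, h1, rfl⟩ := h
  have hmaps : Set.MapsTo (fun t : ℝ => 1 - t) (Set.Icc 0 1) (Set.Icc 0 1) := fun t ht =>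
    ⟨by linarith [ht.2], by linarith [ht.1]⟩
  refine ⟨fun t => γ (1 - t), hc.comp (by fun_prop) hmaps,
    hi.comp (fun s _ t _ h => by simpa using h) hmaps, by simpa using h1, by simpa using h0, ?_⟩
  have : (fun t => γ (1 - t)) = γ ∘ fun t => 1 - t := rfl
  rw [this, Set.image_comp, Set.image_const_sub_Icc]
  simp

theorem isSimpleCurve_segment {p q : Plane} (h : p ≠ q) : IsSimpleCurve p q (segment ℝ p q) := by
  refine ⟨AffineMap.lineMap p q, AffineMap.lineMap_continuous.continuousOn,
    (AffineMap.lineMap_injective ℝ h).injOn, by simp, by simp, ?_⟩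
  rw [segment_eq_image_lineMap]

theorem isSimpleCurve_union_segment {p m q : Plane} (h : signedArea p m q ≠ 0) :
    IsSimpleCurve p q (segment ℝ p m ∪ segment ℝ m q) := by
  have inj : ∀ {a b a' b' : ℝ}, p + a • (m - p) + b • (q - m) = p + a' • (m - p) + b' • (q - m) →
      a = a' ∧ b = b' := by
    intro a b a' b' e
    have e0 := congrArg (fun x : Plane => x 0) e
    have e1 := congrArg (fun x : Plane => x 1) e
    simp only [PiLp.add_apply, PiLp.smul_apply, PiLp.sub_apply, smul_eq_mul] at e0 e1
    have ha : (a - a') * signedArea p m q = 0 := by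
      simp only [signedArea]
      linear_combination (q 1 - m 1) * e0 - (q 0 - m 0) * e1
    have hb : (b - b') * signedArea p m q = 0 := by
      simp only [signedArea]
      linear_combination (m 0 - p 0) * e1 - (m 1 - p 1) * e0
    exact ⟨sub_eq_zero.1 ((mul_eq_zero.1 ha).resolve_right h),
      sub_eq_zero.1 ((mul_eq_zero.1 hb).resolve_right h)⟩
  -- The coefficients run through the first piece and then the second. They sum to `2 * t`, so they
  -- determine the parameter.
  refine ⟨fun t => p + min (2 * t) 1 • (m - p) + max (2 * t - 1) 0 • (q - m),
    Continuous.continuousOn (by fun_prop), ?_, by simp, by simp; norm_num, ?_⟩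
  · intro t _ t' _ e
    obtain ⟨h1, h2⟩ := inj e
    have hsum : ∀ t : ℝ, min (2 * t) 1 + max (2 * t - 1) 0 = 2 * t := by
      intro t
      rcases le_total (2 * t) 1 with ht | ht
      · rw [min_eq_left ht, max_eq_right (by linarith)]; ring
      · rw [min_eq_right ht, max_eq_left (by linarith)]; ring
    linarith [hsum t, hsum t']
  · simp only [segment_eq_image']
    ext x
    simp only [Set.mem_image, Set.mem_union, Set.mem_Icc]
    constructor
    · rintro ⟨t, ⟨ht0, ht1⟩, rfl⟩
      rcases le_total (2 * t) 1 with ht | ht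
      · refine .inl ⟨2 * t, ⟨by linarith, ht⟩, ?_⟩
        rw [min_eq_left ht, max_eq_right (by linarith)]; simp
      · refine .inr ⟨2 * t - 1, ⟨by linarith, by linarith⟩, ?_⟩
        rw [min_eq_right ht, max_eq_left (by linarith)]; simp
    · rintro (⟨t, ⟨ht0, ht1⟩, rfl⟩ | ⟨t, ⟨ht0, ht1⟩, rfl⟩)
      · refine ⟨t / 2, ⟨by linarith, by linarith⟩, ?_⟩
        rw [min_eq_left (by linarith), max_eq_right (by linarith)]
        simp [mul_div_cancel₀]
      · refine ⟨(t + 1) / 2, ⟨by linarith, by linarith⟩, ?_⟩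
        rw [min_eq_right (by linarith), max_eq_left (by linarith)]
        simp [mul_div_cancel₀]

/-- The pieces of the polygonal path from `p` to `q` with at most one bend. -/
def pathPieces (p : ℤ × ℤ) (m : Option (ℤ × ℤ)) (q : ℤ × ℤ) : List ((ℤ × ℤ) × (ℤ × ℤ)) :=
  m.elim [(p, q)] fun m => [(p, m), (m, q)]

/-- The polygonal path from `p` to `q` with at most one bend. -/
def latticePath (p : ℤ × ℤ) (m : Option (ℤ × ℤ)) (q : ℤ × ℤ) : Set Plane :=
  {x | ∃ s ∈ pathPieces p m q, x ∈ latticeSegment s}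

/-- A sufficient condition for the path to be a simple curve. -/
def IsProperPath (p : ℤ × ℤ) (m : Option (ℤ × ℤ)) (q : ℤ × ℤ) : Prop :=
  match m with
  | none => p ≠ q
  | some m => latticeArea p m q ≠ 0

instance (p : ℤ × ℤ) (m : Option (ℤ × ℤ)) (q : ℤ × ℤ) : Decidable (IsProperPath p m q) :=
  match m with
  | none => inferInstanceAs (Decidable (p ≠ q))
  | some m => inferInstanceAs (Decidable (latticeArea p m q ≠ 0))

theorem latticeSegment_swap (p q : ℤ × ℤ) : latticeSegment (p, q) = latticeSegment (q, p) :=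
  segment_symm ..

theorem left_mem_latticePath (p : ℤ × ℤ) (m : Option (ℤ × ℤ)) (q : ℤ × ℤ) :
    latticePoint p ∈ latticePath p m q := by
  cases m with
  | none => exact ⟨(p, q), by simp [pathPieces], left_mem_segment ..⟩
  | some m => exact ⟨(p, m), by simp [pathPieces], left_mem_segment ..⟩

theorem latticePath_symm (p : ℤ × ℤ) (m : Option (ℤ × ℤ)) (q : ℤ × ℤ) :
    latticePath p m q = latticePath q m p := by
  cases m with
  | none => simp [latticePath, pathPieces, latticeSegment_swap p q]
  | some m =>
    ext x
    simp [latticePath, pathPieces, latticeSegment_swap p m, latticeSegment_swap m q, or_comm]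

theorem IsProperPath.isSimpleCurve {p q : ℤ × ℤ} {m : Option (ℤ × ℤ)} (h : IsProperPath p m q) :
    IsSimpleCurve (latticePoint p) (latticePoint q) (latticePath p m q) := by
  cases m with
  | none =>
    convert isSimpleCurve_segment (latticePoint_injective.ne h) using 1
    simp [latticePath, pathPieces, latticeSegment]
  | some m =>
    convert isSimpleCurve_union_segment (p := latticePoint p) (m := latticePoint m)
      (q := latticePoint q) (by rw [signedArea_latticePoint]; exact_mod_cast h) using 1
    ext x
    simp [latticePath, pathPieces, latticeSegment]

/-! ### The planar storyplan with eight frames. -/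

namespace WitnessVertex

/-- The positions of the vertices: three unit squares along the diagonal, and for every `i` an apex
vertex and an edge vertex on opposite sides of the squares. -/
def coord : WitnessVertex → ℤ × ℤ
  | cyc c k => (![-10, 0, 10] c + ![-1, 1, 1, -1] k, ![-10, 0, 10] c + ![-1, -1, 1, 1] k)
  | apex i _ => ![(5, 60), (-60, -5), (-5, -60), (60, 5)] i
  | edg i _ => ![(5, -60), (60, -5), (-5, 60), (-60, 5)] i

/-- The bend of the edge between the apex vertex `apex i j` and the vertex `cyc c k`. -/
def apexBend (i : Fin 4) (c : Fin 3) (k : Fin 4) : Option (ℤ × ℤ) :=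
  -- Offsets from the centre of the square. The `i`-th side faces away from the apex vertex, so its
  -- two ends are reached by bends passing the square on either side; the near vertices need none.
  (![![some (-2, 0), some (3, 0), none, none], ![none, some (0, -3), some (0, 2), none],
    ![none, none, some (2, 0), some (-3, 0)], ![some (0, -2), none, none, some (0, 3)]] i k).map
    fun p => (![-10, 0, 10] c + p.1, ![-10, 0, 10] c + p.2)

/-- The bend of the edge between two vertices. -/
def bend : WitnessVertex → WitnessVertex → Option (ℤ × ℤ)
  | apex i _, cyc c k => apexBend i c k
  | cyc c k, apex i _ => apexBend i c k
  | _, _ => none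

theorem bend_symm (u v : WitnessVertex) : bend u v = bend v u := by
  cases u <;> cases v <;> rfl

/-- The drawing of the edges. -/
def edgePath : Sym2 WitnessVertex → Set Plane :=
  Sym2.lift ⟨fun u v => latticePath (coord u) (bend u v) (coord v), fun u v =>
    (latticePath_symm _ _ _).trans (by rw [bend_symm])⟩

/-- The vertices visible together with `apex i j`. -/
def InFrame (i : Fin 4) (j : Fin 2) : WitnessVertex → Prop
  | cyc _ _ => True
  | apex i' j' => i' = i ∧ j' = j
  | edg i' j' => i' = i ∧ j' = j

/-- The list of the vertices visible together with `apex i j`. -/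
def frameVertices (i : Fin 4) (j : Fin 2) : List WitnessVertex :=
  [apex i j, edg i j] ++ (List.finRange 3).flatMap fun c => (List.finRange 4).map fun k => cyc c k

/-- The list of the edges visible together with `apex i j`. -/
def frameEdges (i : Fin 4) (j : Fin 2) : List (WitnessVertex × WitnessVertex) :=
  (edg i j, apex i j) :: (List.finRange 3).flatMap fun c =>
    [(edg i j, cyc c i), (edg i j, cyc c (i + 1))] ++ (List.finRange 4).flatMap fun k =>
      [(cyc c k, cyc c (k + 1)), (apex i j, cyc c k)]

/-- A sufficient condition for the edges `e` and `f` to meet at most in a common end vertex. -/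
def compatible (e f : WitnessVertex × WitnessVertex) : Bool :=
  (pathPieces (coord e.1) (bend e.1 e.2) (coord e.2)).all fun s =>
  (pathPieces (coord f.1) (bend f.1 f.2) (coord f.2)).all fun s' =>
    -- Either one piece lies strictly on one side of the line through the other, or the pieces are
    -- non-parallel and end at a common vertex.
    decide (0 < latticeArea s.1 s.2 s'.1 * latticeArea s.1 s.2 s'.2) ||
    decide (0 < latticeArea s'.1 s'.2 s.1 * latticeArea s'.1 s'.2 s.2) ||
    [e.1, e.2].any fun w => decide (w ∈ [f.1, f.2] ∧ coord w ∈ [s.1, s.2] ∧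
      coord w ∈ [s'.1, s'.2] ∧ latticeCross s s' ≠ 0)

/-- Planarity of the frames rests on this finite computation with integers. -/
theorem frameEdges_compatible : ∀ (i : Fin 4) (j : Fin 2),
    (frameEdges i j).Pairwise fun e f => compatible e f = true := by
  decide +kernel

theorem frameEdges_isProperPath : ∀ (i : Fin 4) (j : Fin 2), (frameEdges i j).all (fun e =>
    decide (IsProperPath (coord e.1) (bend e.1 e.2) (coord e.2))) = true := by
  decide +kernel

theorem frameVertices_coord_injective : ∀ (i : Fin 4) (j : Fin 2), ∀ u ∈ frameVertices i j,
    ∀ v ∈ frameVertices i j, coord u = coord v → u = v := by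
  decide +kernel

theorem InFrame.mem_frameVertices {i : Fin 4} {j : Fin 2} {v : WitnessVertex}
    (h : InFrame i j v) : v ∈ frameVertices i j := by
  cases v with
  | cyc c k => simp [frameVertices]
  | apex i' j' => obtain ⟨rfl, rfl⟩ := h; simp [frameVertices]
  | edg i' j' => obtain ⟨rfl, rfl⟩ := h; simp [frameVertices]

theorem mem_frameEdges {i : Fin 4} {j : Fin 2} {u v : WitnessVertex} (hu : InFrame i j u)
    (hv : InFrame i j v) (h : witnessGraph.Adj u v) :
    (u, v) ∈ frameEdges i j ∨ (v, u) ∈ frameEdges i j := by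
  have key : ∀ {u v : WitnessVertex}, InFrame i j u → InFrame i j v → WitnessRel u v →
      (u, v) ∈ frameEdges i j := by
    rintro (⟨c, k⟩ | ⟨i', j'⟩ | ⟨i', j'⟩) (⟨c', k'⟩ | ⟨i'', j''⟩ | ⟨i'', j''⟩) hu hv h <;>
      simp only [InFrame, WitnessRel] at hu hv h
    · obtain ⟨rfl, rfl⟩ := h; simp [frameEdges]
    · obtain ⟨rfl, rfl⟩ := hu; simp [frameEdges]
    · obtain ⟨rfl, rfl⟩ := hu; rcases h with rfl | rfl <;> simp [frameEdges]
    · obtain ⟨rfl, rfl⟩ := hu; obtain ⟨rfl, rfl⟩ := hv; simp [frameEdges]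
  rcases (SimpleGraph.fromRel_adj _ _ _).1 h with ⟨-, h | h⟩
  · exact .inl (key hu hv h)
  · exact .inr (key hv hu h)

theorem exists_common_of_compatible {e f : WitnessVertex × WitnessVertex} (h : compatible e f = true)
    {x : Plane} (hx : x ∈ edgePath s(e.1, e.2)) (hx' : x ∈ edgePath s(f.1, f.2)) :
    ∃ w, w ∈ s(e.1, e.2) ∧ w ∈ s(f.1, f.2) ∧ latticePoint (coord w) = x := by
  obtain ⟨s, hs, hx⟩ := hx
  obtain ⟨s', hs', hx'⟩ := hx'
  simp only [compatible, List.all_eq_true, List.any_eq_true, Bool.or_eq_true,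
    decide_eq_true_eq] at h
  rcases h s hs s' hs' with (h | h) | ⟨w, hw, hw', hc, hc', hne⟩
  · refine absurd hx' (Set.disjoint_left.1 (disjoint_segment_of_same_side ?_) hx)
    simp only [signedArea_latticePoint]
    exact_mod_cast h
  · refine absurd hx (Set.disjoint_left.1 (disjoint_segment_of_same_side ?_) hx')
    simp only [signedArea_latticePoint]
    exact_mod_cast h
  · have mem : ∀ {p : ℤ × ℤ} {s : (ℤ × ℤ) × (ℤ × ℤ)}, p ∈ [s.1, s.2] →
        latticePoint p ∈ latticeSegment s := by
      intro p s hp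
      simp only [List.mem_cons, List.not_mem_nil, or_false] at hp
      rcases hp with rfl | rfl
      · exact left_mem_segment ..
      · exact right_mem_segment ..
    exact ⟨w, by simpa using hw, by simpa using hw',
      (eq_of_mem_latticeSegment hne hx hx' (mem hc) (mem hc')).symm⟩

/-- No visible vertex is isolated, so an edge running through a foreign vertex would meet an edge
ending there; the check on pairs of edges covers this case as well. -/
theorem exists_adj_inFrame {i : Fin 4} {j : Fin 2} {v : WitnessVertex} (h : InFrame i j v) :
    ∃ w, InFrame i j w ∧ witnessGraph.Adj v w := by
  cases v with
  | cyc c k => exact ⟨apex i j, ⟨rfl, rfl⟩, (adj_apex_cyc _ _ _ _).symm⟩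
  | apex i' j' => exact ⟨cyc 0 0, trivial, adj_apex_cyc _ _ _ _⟩
  | edg i' j' => exact ⟨apex i' j', h, adj_edg_apex _ _⟩

theorem isPlanarDrawing_frame (i : Fin 4) (j : Fin 2) :
    IsPlanarDrawing witnessGraph {v | InFrame i j v} (fun v => latticePoint (coord v))
      edgePath := by
  have inj : Set.InjOn (fun v => latticePoint (coord v)) {v | InFrame i j v} := fun u hu v hv h =>
    frameVertices_coord_injective i j u hu.mem_frameVertices v hv.mem_frameVertices
      (latticePoint_injective h)
  have proper : ∀ {u v}, (u, v) ∈ frameEdges i j → IsProperPath (coord u) (bend u v) (coord v) :=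
    fun h => of_decide_eq_true (List.all_eq_true.1 (frameEdges_isProperPath i j) _ h)
  have exists_edge : ∀ e ∈ inducedEdges witnessGraph {v | InFrame i j v},
      ∃ p ∈ frameEdges i j, s(p.1, p.2) = e := by
    rintro ⟨u, v⟩ ⟨he, hW⟩
    rcases mem_frameEdges (hW u (by simp)) (hW v (by simp)) he with h | h
    · exact ⟨_, h, rfl⟩
    · exact ⟨_, h, Sym2.eq_swap⟩
  have inter : ∀ e ∈ inducedEdges witnessGraph {v | InFrame i j v},
      ∀ f ∈ inducedEdges witnessGraph {v | InFrame i j v}, e ≠ f → ∀ x, x ∈ edgePath e →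
      x ∈ edgePath f → ∃ v, v ∈ e ∧ v ∈ f ∧ latticePoint (coord v) = x := by
    intro e he f hf hef x hx hx'
    obtain ⟨p, hp, rfl⟩ := exists_edge e he
    obtain ⟨q, hq, rfl⟩ := exists_edge f hf
    have : Std.Symm fun e f : WitnessVertex × WitnessVertex =>
        ∀ x, x ∈ edgePath s(e.1, e.2) → x ∈ edgePath s(f.1, f.2) →
          ∃ v, v ∈ s(e.1, e.2) ∧ v ∈ s(f.1, f.2) ∧ latticePoint (coord v) = x := by
      refine ⟨fun e f h x hx hx' => ?_⟩
      obtain ⟨v, hv, hv', h⟩ := h x hx' hx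
      exact ⟨v, hv', hv, h⟩
    exact ((frameEdges_compatible i j).imp fun h x => exists_common_of_compatible h (x := x)).forall
      hp hq (by rintro rfl; exact hef rfl) x hx hx'
  refine ⟨inj, ?_, ?_, fun e he f hf hef x hx => inter e he f hf hef x hx.1 hx.2⟩
  · intro u hu v hv h
    rcases mem_frameEdges hu hv h with h | h
    · exact (proper h).isSimpleCurve
    · rw [Sym2.eq_swap]
      exact (proper h).isSimpleCurve.symm
  · intro e he v hv hve
    by_contra hne
    obtain ⟨w, hw, hvw⟩ := exists_adj_inFrame hv
    have hf : s(v, w) ∈ inducedEdges witnessGraph {v | InFrame i j v} := by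
      refine ⟨hvw, fun u hu => ?_⟩
      rcases Sym2.mem_iff.1 hu with rfl | rfl
      · exact hv
      · exact hw
    obtain ⟨u, hu, -, h⟩ := inter e he s(v, w) hf (by rintro rfl; simp at hne) _ hve
      (left_mem_latticePath _ _ _)
    exact hne (inj (he.2 u hu) hv h ▸ hu)

/-- A planar storyplan of the witness graph with eight frames, in which `apex i j` and `edg i j` are
visible in a single frame together with all cycle vertices. -/
noncomputable def storyplan : Storyplan witnessGraph 8 where
  first
    | cyc _ _ => 1
    | apex i j => 4 * (j : ℕ) + (i : ℕ) + 1
    | edg i j => 4 * (j : ℕ) + (i : ℕ) + 1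
  last
    | cyc _ _ => 8
    | apex i j => 4 * (j : ℕ) + (i : ℕ) + 1
    | edg i j => 4 * (j : ℕ) + (i : ℕ) + 1
  one_le_first v := by cases v <;> simp
  first_le_last v := by cases v <;> simp
  last_le v := by cases v <;> simp <;> omega
  coOccur u v h := by
    obtain ⟨i, j, hu, hv⟩ : ∃ i j, InFrame i j u ∧ InFrame i j v := by
      rcases (SimpleGraph.fromRel_adj _ _ _).1 h with ⟨-, h | h⟩ <;>
      · cases u <;> cases v <;> simp_all [WitnessRel, InFrame]
    refine ⟨4 * (j : ℕ) + (i : ℕ) + 1, ?_, ?_⟩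
    · cases u <;> simp_all [InFrame]; omega
    · cases v <;> simp_all [InFrame]; omega
  pos v := latticePoint (coord v)
  curve := edgePath

theorem storyplan_isPlanar : storyplan.IsPlanar := by
  rintro t ⟨h1, h8⟩
  -- Frames are numbered from 1 and indices from 0, so `i` and `j` are remainder and quotient of `t
  -- - 1` by 4.
  obtain ⟨i, j, rfl⟩ : ∃ (i : Fin 4) (j : Fin 2), t = 4 * (j : ℕ) + (i : ℕ) + 1 :=
    ⟨⟨(t - 1) % 4, by omega⟩, ⟨(t - 1) / 4, by omega⟩, by simp only; omega⟩
  change IsPlanarDrawing witnessGraph _ (fun v => latticePoint (coord v)) edgePath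
  convert isPlanarDrawing_frame i j using 1
  ext v
  cases v <;> simp [Storyplan.visible, storyplan, InFrame, Fin.ext_iff] <;> omega

end WitnessVertex

theorem theorem1 :
    Fintype.card WitnessVertex = 28 ∧
    AdmitsPlanarStoryplan witnessGraph ∧
    (∃ S : Storyplan witnessGraph 8, S.IsPlanar ∧
      (∀ c k, S.first (.cyc c k) = 1 ∧ S.last (.cyc c k) = 8) ∧
      (∀ (i : Fin 4) (j : Fin 2),
        S.first (.apex i j) = 4 * (j : ℕ) + (i : ℕ) + 1 ∧
        S.last (.apex i j) = 4 * (j : ℕ) + (i : ℕ) + 1 ∧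
        S.first (.edg i j) = 4 * (j : ℕ) + (i : ℕ) + 1 ∧
        S.last (.edg i j) = 4 * (j : ℕ) + (i : ℕ) + 1)) ∧
    ¬ AdmitsPlanarGeometricStoryplan witnessGraph := by
  refine ⟨by decide, ⟨8, storyplan, storyplan_isPlanar⟩, ⟨storyplan, storyplan_isPlanar, ?_, ?_⟩,
    not_admitsPlanarGeometricStoryplan_witnessGraph⟩
  · exact fun _ _ => ⟨rfl, rfl⟩
  · exact fun _ _ => ⟨rfl, rfl, rfl, rfl⟩
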